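/- Let $\mathfrak{A}$ be a (not necessarily unital) $C^*$-algebra and let $\mathscr{X}$ be a right Hilbert $\mathfrak{A}$-module with inner product $\langle\cdot,\cdot\rangle$, linear in the second variable; write $|a|^2=a^*a$ for $a\in\mathfrak{A}$. Let $n\in\mathbb{N}$. For $y=(y_1,\dots,y_n)\in\mathscr{X}^n$ put $$\mu_n^*(y)=\sup\Big\{\Big\|\Big(\sum_{i=1}^n|\langle y_i,z\rangle|^2\Big)^{1/2}\Big\| : z\in\mathscr{X},\ \|z\|\le 1\Big\},$$ and for $x=(x_1,\dots,x_n)\in\mathscr{X}^n$ put $$\|x\|_n^*=\sup\Big\{\Big\|\sum_{i=1}^n|\langle y_i,x_i\rangle|^2\Big\|^{1/2} : y\in\mathscr{X}^n,\ \mu_n^*(y)\le 1\Big\},\qquad \|x\|_n^{\mathscr{X}}=\sup\|P_1x_1+\dots+P_nx_n\|,$$ where the last supremum is over all families $(P_1,\dots,P_n)$ of mutually orthogonal projections (possibly zero) in the algebra of adjointable operators on $\mathscr{X}$ with $P_1+\dots+P_n=I_{\mathscr{X}}$; for a Hilbert space $\mathscr{H}$ (a Hilbert $\mathbb{C}$-module)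 this defines $\|\cdot\|_n^{\mathscr{H}}$. Let $\mathcal{P}(\mathfrak{A})$ be the set of pure states of $\mathfrak{A}$. For $\tau\in\mathcal{P}(\mathfrak{A})$ let $\mathcal{N}_\tau=\{x\in\mathscr{X}:\tau(\langle x,x\rangle)=0\}$ and let $\mathscr{H}_\tau$ be the Hilbert space completion of $\mathscr{X}/\mathcal{N}_\tau$ with respect to $\langle x+\mathcal{N}_\tau,y+\mathcal{N}_\tau\rangle=\tau(\langle x,y\rangle)$. Put $$\|x\|_n^{\mathcal{P}(\mathfrak{A})}=\sup_{\tau\in\mathcal{P}(\mathfrak{A})}\|(x_1+\mathcal{N}_\tau,\dots,x_n+\mathcal{N}_\tau)\|_n^{\mathscr{H}_\tau}$$ (a supremum over the empty set is $0$). Then for every $x\in\mathscr{X}^n$: (1) $\|x\|_n^{\mathscr{X}}\le\|x\|_n^*$; (2) $\|x\|_n^{\mathscr{X}}\le\|x\|_n^{\mathcal{P}(\mathfrak{A})}$; (3) if $\mathfrak{A}$ is commutative and for every $\tau\in\mathcal{P}(\mathfrak{A})$ the Hilbert dimension of $\mathscr{H}_\tau$ (the cardinality of an orthonormal basis) is at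 least $n$, then $\|x\|_n^*\le\|x\|_n^{\mathcal{P}(\mathfrak{A})}$. -/

import Mathlib

open scoped ComplexOrder

noncomputable section

namespace HilbertMultiNorm

section RightModule

/-! A right Hilbert module over a (not necessarily unital) C⋆-algebra `A` is a complete space `E`
with `[SMul Aᵐᵒᵖ E] [CStarModule Aᵐᵒᵖ E]`: Mathlib's `CStarModule B E` is built on a left action of
`B`, with `⟨x, b y⟩ = b ⟨x, y⟩`, so over `B = Aᵐᵒᵖ` it reads `⟨x, y a⟩ = ⟨x, y⟩ a` in `A`.
The module laws for the action follow from the axioms on the inner product. -/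

variable {A E : Type*} [NonUnitalCStarAlgebra A] [PartialOrder A]
  [NormedAddCommGroup E] [NormedSpace ℂ E] [SMul Aᵐᵒᵖ E] [CStarModule Aᵐᵒᵖ E]

variable (A) in
/-- The `A`-valued inner product of a right Hilbert `A`-module, conjugate linear in `x` and linear
in `y`. -/
def rinner (x y : E) : A := MulOpposite.unop (inner Aᵐᵒᵖ x y)

/-- `⟨x, y a⟩ = ⟨x, y⟩ a`. -/
lemma rinner_smul_right (x y : E) (a : A) :
    rinner A x (MulOpposite.op a • y) = rinner A x y * a := by
  simp [rinner]

lemma star_rinner (x y : E) : star (rinner A x y) = rinner A y x := by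
  simp [rinner, ← MulOpposite.unop_star]

lemma rinner_self_nonneg (x : E) : 0 ≤ rinner A x x :=
  CStarModule.inner_self_nonneg (A := Aᵐᵒᵖ) (x := x)

lemma norm_eq_sqrt_norm_rinner_self (x : E) : ‖x‖ = √‖rinner A x x‖ :=
  CStarModule.norm_eq_sqrt_norm_inner_self (A := Aᵐᵒᵖ) x

/-- `|a|² = a⋆ a` in a C⋆-algebra. -/
def absSq (a : A) : A := star a * a

variable [StarOrderedRing A]

variable (A) in
/-- `μ*ₙ(y₁, …, yₙ) = sup { ‖(∑ᵢ |⟨yᵢ, z⟩|²)^(1/2)‖ : ‖z‖ ≤ 1 }`. -/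
def muStar {n : ℕ} (y : Fin n → E) : ℝ :=
  sSup {r : ℝ | ∃ z : E, ‖z‖ ≤ 1 ∧ r = ‖CFC.sqrt (∑ i, absSq (rinner A (y i) z))‖}

variable (A) in
/-- `‖(x₁, …, xₙ)‖*ₙ = sup { ‖∑ᵢ |⟨yᵢ, xᵢ⟩|²‖^(1/2) : μ*ₙ(y₁, …, yₙ) ≤ 1 }`. -/
def starNorm {n : ℕ} (x : Fin n → E) : ℝ :=
  sSup {r : ℝ | ∃ y : Fin n → E, muStar A y ≤ 1 ∧
    r = √‖∑ i, absSq (rinner A (y i) (x i))‖}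

end RightModule

section Projections

/-- `S` is an adjoint of the map `T`, for an inner product with values in `R`. A map that has an
adjoint is called adjointable; linearity and boundedness are automatic in Hilbert modules. -/
def IsAdjoint (R : Type*) {E F : Type*} [Inner R E] [Inner R F] (T : E → F) (S : F → E) : Prop :=
  ∀ x y, inner R (T x) y = inner R x (S y)

/-- `P` is a projection in the algebra of adjointable operators: `P = P⋆ = P²`. -/
structure IsProj (R : Type*) {E : Type*} [Inner R E] (P : E → E) : Prop where
  selfAdjoint : IsAdjoint R P P
  idempotent : ∀ x, P (P x) = P x

/-- `P₁, …, Pₙ` are mutually orthogonal projections (some of them possibly zero) whose sum is the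
identity. -/
structure IsProjFamily (R : Type*) {E : Type*} [AddCommGroup E] [Inner R E] {n : ℕ}
    (P : Fin n → E → E) : Prop where
  isProj : ∀ i, IsProj R (P i)
  orthogonal : ∀ i j, i ≠ j → ∀ x, P i (P j x) = 0
  sum_eq : ∀ x, ∑ i, P i x = x

/-- The Hilbert multi-norm `sup ‖P₁ x₁ + ⋯ + Pₙ xₙ‖` over all families of mutually orthogonal
projections summing to the identity. With `R = Aᵐᵒᵖ` this is the Hilbert C⋆-multi-norm of a right
Hilbert `A`-module, with `R = ℂ` the Hilbert multi-norm of a Hilbert space. -/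
def hilbertMultiNorm (R : Type*) {E : Type*} [NormedAddCommGroup E] [Inner R E] {n : ℕ}
    (x : Fin n → E) : ℝ :=
  sSup {r : ℝ | ∃ P : Fin n → E → E, IsProjFamily R P ∧ r = ‖∑ i, P i (x i)‖}

end Projections

section PureStates

/-- A positive linear functional on a C⋆-algebra as a bounded functional (it is automatically
continuous). -/
def toDual {A : Type*} [NonUnitalCStarAlgebra A] [PartialOrder A] [StarOrderedRing A]
    (τ : A →ₚ[ℂ] ℂ) : A →L[ℂ] ℂ where
  toLinearMap := τ.toLinearMap
  cont := map_continuous τ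

/-- A pure state of a C⋆-algebra: a positive linear functional `τ` of norm one such that every
positive functional `ρ ≤ τ` is a multiple `t τ` with `0 ≤ t ≤ 1`. -/
structure IsPureState {A : Type*} [NonUnitalCStarAlgebra A] [PartialOrder A] [StarOrderedRing A]
    (τ : A →ₚ[ℂ] ℂ) : Prop where
  norm_eq_one : ‖toDual τ‖ = 1
  minimal : ∀ ρ : A →ₚ[ℂ] ℂ, (∀ a, 0 ≤ a → ρ a ≤ τ a) →
    ∃ t : ℝ, 0 ≤ t ∧ t ≤ 1 ∧ ∀ a, ρ a = t * τ a

/-- The set of pure states of `A`. -/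
def PureState (A : Type*) [NonUnitalCStarAlgebra A] [PartialOrder A] [StarOrderedRing A] :=
  {τ : A →ₚ[ℂ] ℂ // IsPureState τ}

end PureStates

section GNS

variable {A : Type*} [NonUnitalCStarAlgebra A] [PartialOrder A]

/-- A copy of the Hilbert module `E`, to carry the semi-inner product `τ(⟨x, y⟩)`. -/
@[nolint unusedArguments]
def PreGNS (_τ : A →ₚ[ℂ] ℂ) (E : Type*) := E

variable (τ : A →ₚ[ℂ] ℂ) (E : Type*)
  [NormedAddCommGroup E] [NormedSpace ℂ E]

instance : AddCommGroup (PreGNS τ E) := inferInstanceAs (AddCommGroup E)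
instance : Module ℂ (PreGNS τ E) := inferInstanceAs (Module ℂ E)

/-- The identity map from `E` to its copy. -/
def toPreGNS : E ≃ₗ[ℂ] PreGNS τ E := LinearEquiv.refl ℂ _

variable [StarOrderedRing A] [SMul Aᵐᵒᵖ E] [CStarModule Aᵐᵒᵖ E]

/-- The semi-inner product `τ(⟨x, y⟩)`. -/
abbrev preGNSCore : PreInnerProductSpace.Core ℂ (PreGNS τ E) where
  inner x y := τ (rinner A ((toPreGNS τ E).symm x) ((toPreGNS τ E).symm y))
  conj_inner_symm x y := by
    rw [← star_rinner (A := A) ((toPreGNS τ E).symm x), map_star τ]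
    exact star_star _
  re_inner_nonneg x :=
    (RCLike.nonneg_iff.mp (τ.map_nonneg (rinner_self_nonneg ((toPreGNS τ E).symm x)))).1
  add_left x y z := by simp [rinner]
  smul_left x y c := by simp [rinner]

instance : SeminormedAddCommGroup (PreGNS τ E) :=
  InnerProductSpace.Core.toSeminormedAddCommGroup (c := preGNSCore τ E)

instance : InnerProductSpace ℂ (PreGNS τ E) :=
  InnerProductSpace.ofCore (preGNSCore τ E)

lemma preGNS_inner (x y : E) :
    inner ℂ (toPreGNS τ E x) (toPreGNS τ E y) = τ (rinner A x y) := rfl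

/-- The Hilbert space `H_τ`: the completion of `E / N_τ`, `N_τ = {x | τ(⟨x, x⟩) = 0}`, with
`⟨x + N_τ, y + N_τ⟩ = τ(⟨x, y⟩)`. The Hausdorff completion of `PreGNS τ E` includes the passage to
the quotient by the vectors of seminorm zero. -/
abbrev GNSSpace := UniformSpace.Completion (PreGNS τ E)

variable {E} in
/-- The class `x + N_τ` in `H_τ`. -/
def gnsClass (x : E) : GNSSpace τ E := (toPreGNS τ E x : UniformSpace.Completion (PreGNS τ E))

lemma gnsClass_inner (x y : E) :
    inner ℂ (gnsClass τ x) (gnsClass τ y) = τ (rinner A x y) := by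
  simp only [gnsClass, UniformSpace.Completion.inner_coe, preGNS_inner]

variable (A) {E} in
/-- The supremum over all pure states `τ` of the Hilbert multi-norm of
`(x₁ + N_τ, …, xₙ + N_τ)` in `H_τ`. -/
def pureNorm {n : ℕ} (x : Fin n → E) : ℝ :=
  ⨆ τ : PureState A, hilbertMultiNorm ℂ (fun i => gnsClass τ.1 (x i))

end GNS

/-- The Hilbert dimension: the cardinal number of an orthonormal basis. -/
def oDim (H : Type*) [NormedAddCommGroup H] [InnerProductSpace ℂ H] [CompleteSpace H] :
    Cardinal :=
  Cardinal.mk ↥(exists_hilbertBasis ℂ H).choose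

end HilbertMultiNorm

end

open scoped ComplexOrder

noncomputable section

/-! ### The order on the opposite algebra, so that Cauchy–Schwarz for `CStarModule` applies over
`Aᵐᵒᵖ`. -/

namespace MulOpposite

/-! (1) Given projections `P i`, put `u i = P i (x i)` and test the dual norm on `y i = u i ⟨u i, u
i⟩^(-1/2)`. These lie in orthogonal ranges and have norm at most one, so Bessel's inequality makes
`y` admissible (`IsProjFamily.muStar_le_one`). Moreover `|⟨y i, x i⟩|² = ⟨u i, u i⟩`, and these sum
to `⟨∑ u i, ∑ u i⟩`. The inverse root need not exist, so it is regularized by `regInvSqrt ε`, at the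
cost of an error `2ε` per term.

(2) For `z = ∑ P i (x i)`, some pure state `τ` attains the norm of `⟨z, z⟩`
(`exists_pureState_apply_eq_norm`: Krein–Milman on a weak-* compact face of the dual ball). The `P
i` induce a projection family on `H_τ`, and `z` keeps its norm there.

(3) Pure states of a commutative algebra are multiplicative (`IsPureState.map_mul`). One attaining
the norm of `∑ |⟨y i, x i⟩|²` therefore turns it into `∑ |⟨[y i], [x i]⟩|²` in `H_τ`, where the
classes `[y i]` satisfy Bessel's inequality (`sum_norm_inner_gnsClass_sq_le`). It remains to treat a
Hilbert space (`sum_norm_inner_sq_le_hilbertMultiNorm_sq`). Bessel says that `e_i ↦ y i` is a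
contraction `T` on `ℂⁿ`. If `T` is injective, polar decomposition writes it as `‖T‖` times the
average of two isometries; isometries give orthonormal families, whose projections appear in the
multi-norm, and convexity of the square concludes. Dimension at least `n` provides an isometry along
which any `T` can be perturbed to an injective one. -/

instance instStarOrderedRingOfNonUnitalRing {A : Type*} [NonUnitalRing A] [PartialOrder A]
    [StarRing A] [StarOrderedRing A] : StarOrderedRing Aᵐᵒᵖ where
  le_iff a b := by
    -- `op` reverses products, so the generator from `s` matches the one from `op (star s)`.
    have key : ∀ p : A, p ∈ AddSubmonoid.closure (Set.range fun s : A => star s * s) ↔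
        op p ∈ AddSubmonoid.closure (Set.range fun s : Aᵐᵒᵖ => star s * s) := by
      intro p
      constructor
      · intro hp
        induction hp using AddSubmonoid.closure_induction with
        | mem x hx =>
          obtain ⟨s, rfl⟩ := hx
          exact AddSubmonoid.subset_closure ⟨op (star s), by simp [← op_star]⟩
        | zero => exact zero_mem _
        | add x y _ _ hx hy => exact add_mem hx hy
      · intro hp
        suffices H : ∀ q : Aᵐᵒᵖ,
            q ∈ AddSubmonoid.closure (Set.range fun s : Aᵐᵒᵖ => star s * s) →
            unop q ∈ AddSubmonoid.closure (Set.range fun s : A => star s * s) from H _ hp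
        intro q hq
        induction hq using AddSubmonoid.closure_induction with
        | mem x hx =>
          obtain ⟨s, rfl⟩ := hx
          exact AddSubmonoid.subset_closure ⟨star (unop s), by simp⟩
        | zero => exact zero_mem _
        | add x y _ _ hx hy => exact add_mem hx hy
    rw [← unop_le_unop, StarOrderedRing.le_iff]
    constructor
    · rintro ⟨p, hp, h⟩
      exact ⟨op p, (key p).1 hp, unop_injective (by simpa using h)⟩
    · rintro ⟨p, hp, h⟩
      exact ⟨unop p, (key _).2 (by simpa using hp), by simp [h]⟩

end MulOpposite

namespace HilbertMultiNorm

/-! ### Algebra of the `A`-valued inner product -/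

section Module

variable {A E : Type*} [NonUnitalCStarAlgebra A] [PartialOrder A]
  [NormedAddCommGroup E] [NormedSpace ℂ E] [SMul Aᵐᵒᵖ E] [CStarModule Aᵐᵒᵖ E]

lemma rinner_add_right (x y z : E) : rinner A x (y + z) = rinner A x y + rinner A x z := by
  simp [rinner]

lemma rinner_complex_smul_right (x y : E) (c : ℂ) : rinner A x (c • y) = c • rinner A x y := by
  simp [rinner]

lemma rinner_sub_right (x y z : E) : rinner A x (y - z) = rinner A x y - rinner A x z := by
  simp [rinner]

lemma rinner_sum_right {ι : Type*} (s : Finset ι) (x : E) (y : ι → E) :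
    rinner A x (∑ i ∈ s, y i) = ∑ i ∈ s, rinner A x (y i) := by
  simp [rinner]

lemma rinner_sum_left {ι : Type*} (s : Finset ι) (x : ι → E) (y : E) :
    rinner A (∑ i ∈ s, x i) y = ∑ i ∈ s, rinner A (x i) y := by
  simp [rinner]

lemma rinner_smul_left (x y : E) (a : A) :
    rinner A (MulOpposite.op a • x) y = star a * rinner A x y := by
  simp [rinner]

lemma norm_sq_eq_norm_rinner_self (x : E) : ‖x‖ ^ 2 = ‖rinner A x x‖ := by
  rw [norm_eq_sqrt_norm_rinner_self (A := A) x, Real.sq_sqrt (norm_nonneg _)]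

lemma eq_of_forall_rinner_eq {x y : E} (h : ∀ z, rinner A z x = rinner A z y) : x = y := by
  have : inner Aᵐᵒᵖ (x - y) (x - y) = 0 := by
    apply MulOpposite.unop_injective
    change rinner A (x - y) (x - y) = 0
    rw [rinner_sub_right, h, sub_self]
  exact sub_eq_zero.1 (CStarModule.inner_self.1 this)

lemma absSq_rinner (y z : E) : absSq (rinner A y z) = rinner A z y * rinner A y z := by
  rw [absSq, star_rinner]

variable [StarOrderedRing A]

lemma absSq_nonneg (a : A) : 0 ≤ absSq a := star_mul_self_nonneg a

lemma sum_absSq_nonneg {ι : Type*} (s : Finset ι) (a : ι → A) : 0 ≤ ∑ i ∈ s, absSq (a i) :=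
  Finset.sum_nonneg fun i _ => absSq_nonneg (a i)

lemma norm_absSq {A : Type*} [NonUnitalCStarAlgebra A] (a : A) : ‖absSq a‖ = ‖a‖ ^ 2 := by
  rw [absSq, CStarRing.norm_star_mul_self, sq]

/-- The `A`-valued Cauchy–Schwarz inequality. -/
lemma absSq_rinner_le (y z : E) : absSq (rinner A y z) ≤ ‖y‖ ^ 2 • rinner A z z := by
  rw [absSq_rinner]
  exact CStarModule.inner_mul_inner_swap_le (A := Aᵐᵒᵖ) (x := y) (y := z)

lemma norm_rinner_le (x y : E) : ‖rinner A x y‖ ≤ ‖x‖ * ‖y‖ :=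
  CStarModule.norm_inner_le (A := Aᵐᵒᵖ) E

lemma norm_cfc_sqrt (a : A) (ha : 0 ≤ a) : ‖CFC.sqrt a‖ = √‖a‖ := by
  have h : ‖CFC.sqrt a‖ ^ 2 = ‖a‖ := by
    rw [sq, ← CStarRing.norm_star_mul_self, (CFC.sqrt_nonneg a).isSelfAdjoint.star_eq,
      CFC.sqrt_mul_sqrt_self a ha]
  rw [← h, Real.sqrt_sq (norm_nonneg _)]

end Module

/-! ### The constraint on `muStar` and boundedness of the suprema -/

section MuStar

variable {A E : Type*} [NonUnitalCStarAlgebra A] [PartialOrder A] [StarOrderedRing A]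
  [NormedAddCommGroup E] [NormedSpace ℂ E] [SMul Aᵐᵒᵖ E] [CStarModule Aᵐᵒᵖ E] {n : ℕ}

lemma norm_sum_absSq_rinner_le (y z : Fin n → E) :
    ‖∑ i, absSq (rinner A (y i) (z i))‖ ≤ ∑ i, (‖y i‖ * ‖z i‖) ^ 2 := by
  refine (norm_sum_le _ _).trans (Finset.sum_le_sum fun i _ => ?_)
  rw [norm_absSq]
  exact pow_le_pow_left₀ (norm_nonneg _) (norm_rinner_le _ _) 2

/-- At the threshold 1 the square root drops out. Boundedness of the set matters in the forward
direction: a real `sSup` of an unbounded set is 0 and would carry no information. -/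
lemma muStar_le_one_iff (y : Fin n → E) :
    muStar A y ≤ 1 ↔ ∀ z : E, ‖z‖ ≤ 1 → ‖∑ i, absSq (rinner A (y i) z)‖ ≤ 1 := by
  have hs : ∀ z : E, ‖CFC.sqrt (∑ i, absSq (rinner A (y i) z))‖ =
      √‖∑ i, absSq (rinner A (y i) z)‖ := fun z => norm_cfc_sqrt _ (sum_absSq_nonneg _ _)
  constructor
  · intro h z hz
    have hb : BddAbove {r : ℝ | ∃ z : E, ‖z‖ ≤ 1 ∧
        r = ‖CFC.sqrt (∑ i, absSq (rinner A (y i) z))‖} := by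
      refine ⟨√(∑ i, (‖y i‖ * 1) ^ 2), ?_⟩
      rintro _ ⟨z, hz, rfl⟩
      rw [hs]
      refine Real.sqrt_le_sqrt ((norm_sum_absSq_rinner_le y fun _ => z).trans ?_)
      gcongr
    have := (le_csSup hb ⟨z, hz, rfl⟩).trans h
    rwa [hs, Real.sqrt_le_one] at this
  · intro h
    refine Real.sSup_le ?_ zero_le_one
    rintro _ ⟨z, hz, rfl⟩
    rw [hs, Real.sqrt_le_one]
    exact h z hz

/-- One positive summand is dominated by the whole sum; homogeneity then removes the restriction to
the unit ball. -/
lemma norm_rinner_le_of_muStar_le_one {y : Fin n → E} (hy : muStar A y ≤ 1) (i : Fin n) (x : E) :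
    ‖rinner A (y i) x‖ ≤ ‖x‖ := by
  have h1 : ∀ z : E, ‖z‖ ≤ 1 → ‖rinner A (y i) z‖ ≤ 1 := by
    intro z hz
    have := CStarAlgebra.norm_le_norm_of_nonneg_of_le (absSq_nonneg (rinner A (y i) z))
      (Finset.single_le_sum (f := fun i => absSq (rinner A (y i) z))
        (fun j _ => absSq_nonneg _) (Finset.mem_univ i))
    rw [norm_absSq] at this
    nlinarith [(muStar_le_one_iff y).1 hy z hz, norm_nonneg (rinner A (y i) z)]
  rcases eq_or_ne x 0 with rfl | hx
  · simp [rinner]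
  have hx' : 0 < ‖x‖ := norm_pos_iff.2 hx
  have := h1 (((‖x‖⁻¹ : ℝ) : ℂ) • x) (by simp [norm_smul, hx'.ne'])
  rw [rinner_complex_smul_right, norm_smul] at this
  simp only [Complex.norm_real, norm_inv, norm_norm] at this
  rwa [inv_mul_le_iff₀ hx', mul_one] at this

lemma bddAbove_starNorm (x : Fin n → E) :
    BddAbove {r : ℝ | ∃ y : Fin n → E, muStar A y ≤ 1 ∧
      r = √‖∑ i, absSq (rinner A (y i) (x i))‖} := by
  refine ⟨√(∑ i, ‖x i‖ ^ 2), ?_⟩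
  rintro _ ⟨y, hy, rfl⟩
  refine Real.sqrt_le_sqrt ((norm_sum_le _ _).trans (Finset.sum_le_sum fun i _ => ?_))
  rw [norm_absSq]
  exact pow_le_pow_left₀ (norm_nonneg _) (norm_rinner_le_of_muStar_le_one hy i _) 2

lemma norm_sum_absSq_le_starNorm_sq (x y : Fin n → E) (hy : muStar A y ≤ 1) :
    ‖∑ i, absSq (rinner A (y i) (x i))‖ ≤ starNorm A x ^ 2 := by
  have h : √‖∑ i, absSq (rinner A (y i) (x i))‖ ≤ starNorm A x :=
    le_csSup (bddAbove_starNorm x) ⟨y, hy, rfl⟩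
  calc _ = √‖∑ i, absSq (rinner A (y i) (x i))‖ ^ 2 := (Real.sq_sqrt (norm_nonneg _)).symm
    _ ≤ _ := pow_le_pow_left₀ (Real.sqrt_nonneg _) h 2

end MuStar

/-! ### Regularized normalization of a module vector -/

section Normalize

/-- `t ↦ √t / (|t| + ε)`, a regularization of `t ↦ t^(-1/2)` that vanishes at zero. -/
def regInvSqrt (ε t : ℝ) : ℝ := √t / (|t| + ε)

lemma continuous_regInvSqrt {ε : ℝ} (hε : 0 < ε) : Continuous (regInvSqrt ε) := by
  unfold regInvSqrt
  exact Real.continuous_sqrt.div (by fun_prop) fun t => by positivity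

@[simp] lemma regInvSqrt_zero (ε : ℝ) : regInvSqrt ε 0 = 0 := by simp [regInvSqrt]

lemma mul_regInvSqrt_sq {ε t : ℝ} (ht : 0 ≤ t) :
    regInvSqrt ε t * t * regInvSqrt ε t = t ^ 2 / (t + ε) ^ 2 := by
  rw [regInvSqrt, abs_of_nonneg ht]
  calc _ = √t ^ 2 * t / (t + ε) ^ 2 := by rw [div_mul_eq_mul_div, div_mul_div_comm]; ring
    _ = _ := by rw [Real.sq_sqrt ht, ← sq]

lemma abs_mul_regInvSqrt_sq_le {ε t : ℝ} (hε : 0 < ε) (ht : 0 ≤ t) :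
    |regInvSqrt ε t * t * regInvSqrt ε t| ≤ 1 := by
  rw [mul_regInvSqrt_sq ht, abs_of_nonneg (by positivity), div_le_one (by positivity)]
  gcongr
  linarith

lemma abs_sub_sq_mul_regInvSqrt_sq_le {ε t : ℝ} (hε : 0 < ε) (ht : 0 ≤ t) :
    |t - t * regInvSqrt ε t * (regInvSqrt ε t * t)| ≤ 2 * ε := by
  have h : t * regInvSqrt ε t * (regInvSqrt ε t * t) = t * (t ^ 2 / (t + ε) ^ 2) := by
    rw [← mul_regInvSqrt_sq ht]; ring
  have h2 : t - t * (t ^ 2 / (t + ε) ^ 2) = (2 * ε * t ^ 2 + ε ^ 2 * t) / (t + ε) ^ 2 := by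
    field_simp; ring
  rw [h, h2, abs_of_nonneg (by positivity), div_le_iff₀ (by positivity)]
  nlinarith [mul_nonneg (sq_nonneg ε) ht, pow_pos hε 3]

variable {A E : Type*} [NonUnitalCStarAlgebra A] [PartialOrder A] [StarOrderedRing A]
  [NormedAddCommGroup E] [NormedSpace ℂ E] [SMul Aᵐᵒᵖ E] [CStarModule Aᵐᵒᵖ E]

/-- `u ⟨u, u⟩^(-1/2)` up to regularization: a multiple of `u` of norm at most one. -/
def normalize (A : Type*) {E : Type*} [NonUnitalCStarAlgebra A] [PartialOrder A]
    [StarOrderedRing A] [NormedAddCommGroup E] [NormedSpace ℂ E] [SMul Aᵐᵒᵖ E]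
    [CStarModule Aᵐᵒᵖ E] (ε : ℝ) (u : E) : E :=
  MulOpposite.op (cfcₙ (regInvSqrt ε) (rinner A u u)) • u

lemma star_cfcₙ_regInvSqrt {A : Type*} [NonUnitalCStarAlgebra A] (ε : ℝ) (a : A) :
    star (cfcₙ (regInvSqrt ε) a) = cfcₙ (regInvSqrt ε) a :=
  (IsSelfAdjoint.cfcₙ (f := regInvSqrt ε) (a := a)).star_eq

lemma rinner_normalize_left (ε : ℝ) (u v : E) :
    rinner A (normalize A ε u) v = cfcₙ (regInvSqrt ε) (rinner A u u) * rinner A u v := by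
  rw [normalize, rinner_smul_left, star_cfcₙ_regInvSqrt]

lemma rinner_normalize_right (ε : ℝ) (u v : E) :
    rinner A v (normalize A ε u) = rinner A v u * cfcₙ (regInvSqrt ε) (rinner A u u) := by
  rw [normalize, rinner_smul_right]

lemma norm_normalize_le {ε : ℝ} (hε : 0 < ε) (u : E) : ‖normalize A ε u‖ ≤ 1 := by
  have hc := rinner_self_nonneg (A := A) u
  have hf := continuous_regInvSqrt hε
  rw [norm_eq_sqrt_norm_rinner_self (A := A), Real.sqrt_le_one, rinner_normalize_left,
    rinner_normalize_right]
  set c := rinner A u u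
  have h : cfcₙ (regInvSqrt ε) c * (c * cfcₙ (regInvSqrt ε) c) =
      cfcₙ (fun t => regInvSqrt ε t * t * regInvSqrt ε t) c := by
    rw [cfcₙ_mul (fun t => regInvSqrt ε t * t) (regInvSqrt ε) c, cfcₙ_mul (regInvSqrt ε) (fun t => t) c,
      cfcₙ_id' ℝ c, mul_assoc]
  rw [h]
  exact norm_cfcₙ_le fun t ht => abs_mul_regInvSqrt_sq_le hε (quasispectrum_nonneg_of_nonneg c hc t ht)

/-- With `c = ⟨u, u⟩`, this measures how far `|⟨normalize u, u⟩|²` is from `⟨u, u⟩`; functional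
calculus reduces it to a scalar estimate on `t ≥ 0`. -/
lemma norm_sub_absSq_regInvSqrt_mul_le {ε : ℝ} (hε : 0 < ε) {c : A} (hc : 0 ≤ c) :
    ‖c - absSq (cfcₙ (regInvSqrt ε) c * c)‖ ≤ 2 * ε := by
  have hf := continuous_regInvSqrt hε
  have h : c - absSq (cfcₙ (regInvSqrt ε) c * c) =
      cfcₙ (fun t => t - t * regInvSqrt ε t * (regInvSqrt ε t * t)) c := by
    rw [cfcₙ_sub (fun t => t) (fun t => t * regInvSqrt ε t * (regInvSqrt ε t * t)) c,
      cfcₙ_mul (fun t => t * regInvSqrt ε t) (fun t => regInvSqrt ε t * t) c,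
      cfcₙ_mul (fun t => t) (regInvSqrt ε) c,
      cfcₙ_mul (regInvSqrt ε) (fun t => t) c, cfcₙ_id' ℝ c, absSq, star_mul, star_cfcₙ_regInvSqrt,
      hc.isSelfAdjoint.star_eq]
  rw [h]
  exact norm_cfcₙ_le fun t ht =>
    abs_sub_sq_mul_regInvSqrt_sq_le hε (quasispectrum_nonneg_of_nonneg c hc t ht)

end Normalize

/-! ### Projection families on the module and inequality (1) -/

section Projections

variable {A E : Type*} [NonUnitalCStarAlgebra A] [PartialOrder A]
  [NormedAddCommGroup E] [NormedSpace ℂ E] [SMul Aᵐᵒᵖ E] [CStarModule Aᵐᵒᵖ E] {n : ℕ}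

lemma IsProj.rinner_left {P : E → E} (hP : IsProj Aᵐᵒᵖ P) (x y : E) :
    rinner A (P x) y = rinner A x (P y) :=
  congrArg MulOpposite.unop (hP.selfAdjoint x y)

/-- Moving `P` to the other side of the inner product makes it automatically linear. -/
lemma IsProj.map_add {P : E → E} (hP : IsProj Aᵐᵒᵖ P) (x y : E) : P (x + y) = P x + P y :=
  eq_of_forall_rinner_eq (A := A) fun z => by
    simp only [rinner_add_right, ← hP.rinner_left]

lemma IsProj.map_smul {P : E → E} (hP : IsProj Aᵐᵒᵖ P) (c : ℂ) (x : E) : P (c • x) = c • P x :=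
  eq_of_forall_rinner_eq (A := A) fun z => by
    simp only [rinner_complex_smul_right, ← hP.rinner_left]

lemma IsProj.map_op_smul {P : E → E} (hP : IsProj Aᵐᵒᵖ P) (a : A) (x : E) :
    P (MulOpposite.op a • x) = MulOpposite.op a • P x :=
  eq_of_forall_rinner_eq (A := A) fun z => by
    simp only [rinner_smul_right, ← hP.rinner_left]

lemma IsProjFamily.rinner_map_map {P : Fin n → E → E} (hP : IsProjFamily Aᵐᵒᵖ P) {i j : Fin n}
    (hij : i ≠ j) (x y : E) : rinner A (P i x) (P j y) = 0 := by
  rw [(hP.isProj i).rinner_left, hP.orthogonal i j hij]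
  simp [rinner]

/-- Pythagoras' theorem for a family of orthogonal projections. -/
lemma IsProjFamily.rinner_sum_self {P : Fin n → E → E} (hP : IsProjFamily Aᵐᵒᵖ P)
    (x : Fin n → E) :
    rinner A (∑ i, P i (x i)) (∑ i, P i (x i)) = ∑ i, rinner A (P i (x i)) (P i (x i)) := by
  rw [rinner_sum_left]
  refine Finset.sum_congr rfl fun i _ => ?_
  rw [rinner_sum_right]
  exact Finset.sum_eq_single i (fun j _ hj => hP.rinner_map_map hj.symm _ _) (by simp)

variable [StarOrderedRing A]

/-- Bessel's inequality: since `⟨y i, z⟩ = ⟨y i, P i z⟩`, Cauchy–Schwarz bounds each term by `⟨P i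
z, P i z⟩`, and these add up to `⟨z, z⟩`. -/
lemma IsProjFamily.muStar_le_one {P : Fin n → E → E} (hP : IsProjFamily Aᵐᵒᵖ P)
    {y : Fin n → E} (hy : ∀ i, P i (y i) = y i) (hy1 : ∀ i, ‖y i‖ ≤ 1) : muStar A y ≤ 1 := by
  rw [muStar_le_one_iff]
  intro z hz
  have h : ∑ i, absSq (rinner A (y i) z) ≤ rinner A z z := by
    calc _ ≤ ∑ i, rinner A (P i z) (P i z) := by
          refine Finset.sum_le_sum fun i _ => ?_
          rw [← hy i, (hP.isProj i).rinner_left]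
          refine (absSq_rinner_le _ _).trans ?_
          have := rinner_self_nonneg (A := A) (P i z)
          calc _ ≤ (1 : ℝ) • rinner A (P i z) (P i z) :=
                smul_le_smul_of_nonneg_right (pow_le_one₀ (norm_nonneg _) (hy1 i)) this
            _ = _ := one_smul _ _
      _ = rinner A z z := by rw [← hP.rinner_sum_self fun _ => z, hP.sum_eq]
  refine (CStarAlgebra.norm_le_norm_of_nonneg_of_le (sum_absSq_nonneg _ _) h).trans ?_
  rw [← norm_sq_eq_norm_rinner_self]
  exact pow_le_one₀ (norm_nonneg _) hz

lemma IsProjFamily.norm_sum_le_starNorm {P : Fin n → E → E} (hP : IsProjFamily Aᵐᵒᵖ P)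
    (x : Fin n → E) : ‖∑ i, P i (x i)‖ ≤ starNorm A x := by
  have hs : 0 ≤ starNorm A x := Real.sSup_nonneg (by rintro _ ⟨y, -, rfl⟩; positivity)
  refine (pow_le_pow_iff_left₀ (norm_nonneg _) hs two_ne_zero).1 ?_
  refine le_of_forall_pos_le_add fun δ hδ => ?_
  -- Each of the `n` summands will contribute an error of at most `2 * ε`.
  obtain ⟨ε, hε, hδε⟩ : ∃ ε : ℝ, 0 < ε ∧ n * (2 * ε) ≤ δ := by
    refine ⟨δ / (2 * (n + 1)), by positivity, ?_⟩
    rw [← mul_div_assoc, ← mul_div_assoc, div_le_iff₀ (by positivity)]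
    nlinarith
  set u : Fin n → E := fun i => P i (x i)
  have hPu : ∀ i, P i (u i) = u i := fun i => (hP.isProj i).idempotent _
  have hux : ∀ i, rinner A (u i) (x i) = rinner A (u i) (u i) := fun i => by
    conv_lhs => rw [← hPu i, (hP.isProj i).rinner_left]
  have hmu : muStar A (fun i => normalize A ε (u i)) ≤ 1 :=
    hP.muStar_le_one (fun i => by rw [normalize, (hP.isProj i).map_op_smul, hPu])
      fun i => norm_normalize_le hε _
  have hle := norm_sum_absSq_le_starNorm_sq x _ hmu
  have hdiff : ‖∑ i, rinner A (u i) (u i) -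
      ∑ i, absSq (rinner A (normalize A ε (u i)) (x i))‖ ≤ n * (2 * ε) := by
    rw [← Finset.sum_sub_distrib]
    refine (norm_sum_le _ _).trans ((Finset.sum_le_card_nsmul _ _ (2 * ε) fun i _ => ?_).trans ?_)
    · rw [rinner_normalize_left, hux]
      exact norm_sub_absSq_regInvSqrt_mul_le hε (rinner_self_nonneg _)
    · simp
  rw [norm_sq_eq_norm_rinner_self (A := A), hP.rinner_sum_self]
  have := norm_sub_norm_le (∑ i, rinner A (u i) (u i))
    (∑ i, absSq (rinner A (normalize A ε (u i)) (x i)))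
  linarith

theorem hilbertMultiNorm_le_starNorm (x : Fin n → E) :
    hilbertMultiNorm Aᵐᵒᵖ x ≤ starNorm A x := by
  -- Nonnegativity of the bound covers an empty set of families (`n = 0`, `E` nonzero), where the
  -- supremum is 0.
  refine Real.sSup_le ?_ (Real.sSup_nonneg (by rintro _ ⟨y, -, rfl⟩; positivity))
  rintro _ ⟨P, hP, rfl⟩
  exact hP.norm_sum_le_starNorm x

end Projections

/-! ### Positivity and norms of functionals -/

section PositiveFunctionals

lemma norm_two_smul_sub_one_le {B : Type*} [CStarAlgebra B] [PartialOrder B] [StarOrderedRing B]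
    {a : B} (ha : 0 ≤ a) (ha1 : ‖a‖ ≤ 1) : ‖(2 : ℝ) • a - 1‖ ≤ 1 := by
  have h : (2 : ℝ) • a - 1 = cfc (fun t : ℝ => 2 * t - 1) a := by
    rw [cfc_sub (fun t : ℝ => 2 * t) (fun _ => 1) a, cfc_const_mul 2 (fun t : ℝ => t) a,
      cfc_id' ℝ a, cfc_const_one ℝ a]
  rw [h]
  refine norm_cfc_le zero_le_one fun t ht => ?_
  have h0 : 0 ≤ t := spectrum_nonneg_of_nonneg ha ht
  have h1 : t ≤ 1 := by
    have : Nontrivial B := by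
      by_contra hB
      rw [not_nontrivial_iff_subsingleton] at hB
      simp at ht
    have := spectrum.norm_le_norm_of_mem ht
    rw [Real.norm_of_nonneg h0] at this
    exact this.trans ha1
  rw [Real.norm_eq_abs, abs_le]
  constructor <;> linarith

/-- Both `1` and `2a - 1` are contractions, so `g 1` and `2 - g 1` lie in the unit disc, which
forces `g 1 = 1`. A unital contraction is then positive by the classical argument below. -/
lemma nonneg_of_apply_eq_one_of_unital {B : Type*} [CStarAlgebra B] [PartialOrder B]
    [StarOrderedRing B] {g : B →L[ℂ] ℂ} (hg : ‖g‖ ≤ 1) {a : B} (ha : 0 ≤ a) (ha1 : ‖a‖ ≤ 1)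
    (hga : g a = 1) {b : B} (hb : 0 ≤ b) : 0 ≤ g b := by
  have hle : ∀ c, ‖g c‖ ≤ ‖c‖ := fun c => by
    simpa using g.le_of_opNorm_le hg c
  have hreal : ∀ (r : ℝ) (c : B), g (r • c) = r * g c := fun r c => by
    rw [← Complex.coe_smul, map_smul, smul_eq_mul]
  have hone : ‖(1 : B)‖ ≤ 1 := by
    nontriviality B
    rw [CStarRing.norm_one]
  have hg1 : g 1 = 1 := by
    have h1 : ‖g 1‖ ≤ 1 := (hle 1).trans hone
    have h2 : ‖2 - g 1‖ ≤ 1 := by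
      have := (hle _).trans (norm_two_smul_sub_one_le ha ha1)
      rw [map_sub, hreal, hga] at this
      simpa using this
    have e1 := Complex.sq_norm (g 1)
    have e2 := Complex.sq_norm (2 - g 1)
    rw [Complex.normSq_apply] at e1 e2
    simp only [Complex.sub_re, Complex.sub_im, Complex.re_ofNat, Complex.im_ofNat] at e2
    have n1 := pow_le_one₀ (n := 2) (norm_nonneg _) h1
    have n2 := pow_le_one₀ (n := 2) (norm_nonneg _) h2
    have hre : (g 1).re = 1 := by nlinarith [sq_nonneg ((g 1).re - 1), sq_nonneg (g 1).im]
    have him : (g 1).im = 0 := by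
      have : (g 1).im * (g 1).im ≤ 0 := by nlinarith
      nlinarith [sq_nonneg (g 1).im]
    exact Complex.ext hre him
  suffices H : ∀ c : B, 0 ≤ c → ‖c‖ ≤ 1 → 0 ≤ g c by
    rcases eq_or_ne b 0 with rfl | hb0
    · simp
    have hpos : 0 < ‖b‖ := norm_pos_iff.2 hb0
    have := H (‖b‖⁻¹ • b) (smul_nonneg (by positivity) hb) (by simp [norm_smul, hpos.ne'])
    rw [hreal] at this
    have h2 := mul_nonneg (Complex.zero_le_real.2 hpos.le) this
    rwa [← mul_assoc, ← Complex.ofReal_mul, mul_inv_cancel₀ hpos.ne', Complex.ofReal_one,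
      one_mul] at h2
  intro c hc hc1
  set h : B := (2 : ℝ) • c - 1 with hh
  have hn : ‖h‖ ≤ 1 := norm_two_smul_sub_one_le hc hc1
  have hsa : star h = h := by
    simp [hh, hc.isSelfAdjoint.star_eq]
  have hgh : g h = 2 * g c - 1 := by rw [hh, map_sub, hreal, hg1]; simp
  -- Compare `|g (h + iN)|²` with `‖h + iN‖² ≤ 1 + N²`. Validity for all real `N` excludes a nonzero
  -- imaginary part.
  have hN : ∀ N : ℝ, 2 * N * (g h).im + (g h).im ^ 2 ≤ 1 := by
    intro N
    have k1 : ‖h + ((N : ℂ) * Complex.I) • (1 : B)‖ ^ 2 ≤ 1 + N ^ 2 := by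
      rw [sq, ← CStarRing.norm_star_mul_self]
      have : star (h + ((N : ℂ) * Complex.I) • (1 : B)) * (h + ((N : ℂ) * Complex.I) • (1 : B)) =
          h * h + ((N : ℂ) ^ 2) • (1 : B) := by
        simp only [star_add, hsa, star_smul, star_one, star_mul', RCLike.star_def,
          Complex.conj_ofReal, Complex.conj_I, add_mul, mul_add, smul_mul_assoc, mul_smul_comm,
          mul_one, one_mul]
        have e : ((N : ℂ) * Complex.I) * ((N : ℂ) * -Complex.I) = (N : ℂ) ^ 2 := by
          linear_combination (-(N : ℂ) ^ 2) * Complex.I_sq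
        rw [← e]
        module
      rw [this]
      refine (norm_add_le _ _).trans (add_le_add ?_ ?_)
      · exact (norm_mul_le _ _).trans (mul_le_one₀ hn (norm_nonneg _) hn)
      · rw [norm_smul]
        simp only [norm_pow, Complex.norm_real, Real.norm_eq_abs, sq_abs]
        exact mul_le_of_le_one_right (sq_nonneg N) hone
    have k2 := (pow_le_pow_left₀ (norm_nonneg _) (hle _) 2).trans k1
    rw [map_add, map_smul, hg1, Complex.sq_norm, Complex.normSq_apply] at k2
    simp only [Complex.add_re, Complex.add_im, smul_eq_mul, mul_one, Complex.mul_re,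
      Complex.mul_im, Complex.ofReal_re, Complex.ofReal_im, Complex.I_re, Complex.I_im] at k2
    nlinarith [sq_nonneg (g h).re]
  have him : (g h).im = 0 := by
    by_contra hne
    have := hN (1 / (g h).im)
    have e : 2 * (1 / (g h).im) * (g h).im = 2 := by field_simp
    nlinarith [sq_nonneg (g h).im]
  have hre : -1 ≤ (g h).re := by
    have := (Complex.abs_re_le_norm (g h)).trans ((hle h).trans hn)
    exact (abs_le.1 this).1
  rw [hgh] at him hre
  simp only [Complex.sub_re, Complex.sub_im, Complex.mul_re, Complex.mul_im, Complex.re_ofNat,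
    Complex.im_ofNat, Complex.one_re, Complex.one_im] at him hre
  rw [Complex.nonneg_iff]
  constructor <;> linarith

variable {A : Type*} [NonUnitalCStarAlgebra A]

open Unitization in
-- Hahn–Banach along the isometric embedding of `A` in its unitization.
lemma exists_extension_unitization (f : A →L[ℂ] ℂ) :
    ∃ g : Unitization ℂ A →L[ℂ] ℂ, ‖g‖ ≤ ‖f‖ ∧ ∀ a : A, g a = f a := by
  let ι : A →ₗᵢ[ℂ] Unitization ℂ A :=
    { toLinearMap := inrHom ℂ ℂ A
      norm_map' := fun a => norm_inr (𝕜 := ℂ) a }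
  obtain ⟨g, hg, hgn⟩ := exists_extension_norm_eq ι.range
    (f ∘L (ι.equivRange.symm.toLinearIsometry.toContinuousLinearMap))
  refine ⟨g, hgn.trans_le ?_, fun a => ?_⟩
  · refine ContinuousLinearMap.opNorm_le_bound _ (norm_nonneg _) fun x => ?_
    refine (f.le_opNorm _).trans_eq ?_
    simp
  · have h : g (ι a) = f (ι.equivRange.symm (ι.equivRange a)) := hg (ι.equivRange a)
    rwa [LinearIsometryEquiv.symm_apply_apply] at h

variable [PartialOrder A]

lemma ofReal_re_apply_of_nonneg (τ : A →ₚ[ℂ] ℂ) {a : A} (ha : 0 ≤ a) : (((τ a).re : ℝ) : ℂ) = τ a :=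
  Complex.ext rfl (by simpa using (Complex.nonneg_iff.1 (τ.map_nonneg ha)).2)

lemma re_apply_nonneg (τ : A →ₚ[ℂ] ℂ) {a : A} (ha : 0 ≤ a) : 0 ≤ (τ a).re :=
  (Complex.nonneg_iff.1 (τ.map_nonneg ha)).1

lemma re_apply_mono (τ : A →ₚ[ℂ] ℂ) {a b : A} (hab : a ≤ b) : (τ a).re ≤ (τ b).re :=
  (Complex.le_def.1 (OrderHomClass.mono τ hab)).1

lemma apply_real_smul (τ : A →ₚ[ℂ] ℂ) (r : ℝ) (a : A) : τ (r • a) = r * τ a := by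
  rw [← Complex.coe_smul, map_smul, smul_eq_mul]

variable [StarOrderedRing A]

/-- A functional in the dual unit ball which is `1` at some positive `a` of norm at most one is
positive. -/
lemma nonneg_of_apply_eq_one {f : A →L[ℂ] ℂ} (hf : ‖f‖ ≤ 1) {a : A} (ha : 0 ≤ a)
    (ha1 : ‖a‖ ≤ 1) (hfa : f a = 1) {b : A} (hb : 0 ≤ b) : 0 ≤ f b := by
  obtain ⟨g, hg, hgf⟩ := exists_extension_unitization f
  rw [← hgf b]
  refine nonneg_of_apply_eq_one_of_unital (hg.trans hf) (a := (a : Unitization ℂ A))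
    (Unitization.inr_nonneg_iff.2 ha) ?_ (by rw [hgf, hfa]) (Unitization.inr_nonneg_iff.2 hb)
  rwa [Unitization.norm_inr]

lemma toDual_apply (τ : A →ₚ[ℂ] ℂ) (a : A) : toDual τ a = τ a := rfl

lemma re_apply_le_norm (τ : A →ₚ[ℂ] ℂ) (a : A) : (τ a).re ≤ ‖toDual τ‖ * ‖a‖ :=
  (Complex.re_le_norm _).trans ((toDual τ).le_opNorm a)

/-- The Cauchy–Schwarz inequality for a positive functional. -/
lemma norm_apply_star_mul_sq_le (τ : A →ₚ[ℂ] ℂ) (a b : A) :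
    ‖τ (star a * b)‖ ^ 2 ≤ (τ (star a * a)).re * (τ (star b * b)).re := by
  have h := norm_inner_le_norm (𝕜 := ℂ) (τ.toPreGNS a) (τ.toPreGNS b)
  have hn : ∀ c, ‖τ.toPreGNS c‖ ^ 2 = (τ (star c * c)).re := fun c => by
    rw [PositiveLinearMap.preGNS_norm_def]
    exact Real.sq_sqrt (re_apply_nonneg τ (star_mul_self_nonneg _))
  rw [← hn, ← hn, ← mul_pow]
  exact pow_le_pow_left₀ (norm_nonneg _) h 2

/-- Along an approximate unit `e`, Cauchy–Schwarz gives `|τ (e x)|² ≤ τ (e²) τ (x⋆ x) ≤ K · K ‖x‖²`.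
The open ball is used because its positive part is directed. -/
lemma norm_toDual_le_of_forall_re_le (τ : A →ₚ[ℂ] ℂ) {K : ℝ}
    (hK : ∀ b : A, 0 ≤ b → ‖b‖ < 1 → (τ b).re ≤ K) : ‖toDual τ‖ ≤ K := by
  have hK0 : 0 ≤ K := by simpa using hK 0 le_rfl (by simp)
  have hKb : ∀ b : A, 0 ≤ b → (τ b).re ≤ K * ‖b‖ := by
    intro b hb
    refine le_of_forall_pos_le_add fun δ hδ => ?_
    obtain ⟨η, hη, hηδ⟩ : ∃ η : ℝ, 0 < η ∧ K * η ≤ δ := by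
      refine ⟨δ / (K + 1), by positivity, ?_⟩
      rw [← mul_div_assoc, div_le_iff₀ (by positivity)]
      nlinarith
    have hr : 0 < ‖b‖ + η := by positivity
    have h := hK ((‖b‖ + η)⁻¹ • b) (smul_nonneg (by positivity) hb) (by
      rw [norm_smul, norm_inv, Real.norm_of_nonneg hr.le, inv_mul_lt_iff₀ hr]
      linarith)
    rw [apply_real_smul, Complex.re_ofReal_mul, inv_mul_le_iff₀ hr] at h
    nlinarith
  refine ContinuousLinearMap.opNorm_le_bound _ hK0 fun x => ?_
  rw [toDual_apply]
  have hl := CStarAlgebra.increasingApproximateUnit A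
  have ht : Filter.Tendsto (fun e => ‖τ (e * x)‖ ^ 2) (CStarAlgebra.approximateUnit A)
      (nhds (‖τ x‖ ^ 2)) :=
    ((((toDual τ).continuous.tendsto x).comp (hl.tendsto_mul_right x)).norm).pow 2
  have hb : ‖τ x‖ ^ 2 ≤ (K * ‖x‖) ^ 2 := by
    refine le_of_tendsto ht ?_
    filter_upwards [hl.eventually_norm, hl.eventually_star_eq] with e he hes
    have h := norm_apply_star_mul_sq_le τ e x
    rw [hes] at h
    have h1 : (τ (e * e)).re ≤ K := by
      refine (hKb _ ?_).trans (mul_le_of_le_one_right hK0 ?_)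
      · simpa [hes] using star_mul_self_nonneg e
      · exact (norm_mul_le _ _).trans (mul_le_one₀ he (norm_nonneg _) he)
    have h2 : (τ (star x * x)).re ≤ K * ‖x‖ ^ 2 := by
      have := hKb _ (star_mul_self_nonneg x)
      rwa [CStarRing.norm_star_mul_self, ← sq] at this
    calc _ ≤ _ := h
      _ ≤ K * (K * ‖x‖ ^ 2) :=
        mul_le_mul h1 h2 (re_apply_nonneg τ (star_mul_self_nonneg x)) hK0
      _ = _ := by ring
  exact (pow_le_pow_iff_left₀ (norm_nonneg _) (by positivity) two_ne_zero).1 hb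

lemma exists_lt_re_apply (τ : A →ₚ[ℂ] ℂ) {δ : ℝ} (hδ : 0 < δ) :
    ∃ b : A, 0 ≤ b ∧ ‖b‖ < 1 ∧ ‖toDual τ‖ - δ < (τ b).re := by
  by_contra! h
  linarith [norm_toDual_le_of_forall_re_le τ h]

/-- The norm is additive on positive functionals. -/
lemma norm_toDual_add_norm_toDual_le {τ ρ σ : A →ₚ[ℂ] ℂ} (h : ∀ a, τ a = ρ a + σ a) :
    ‖toDual ρ‖ + ‖toDual σ‖ ≤ ‖toDual τ‖ := by
  refine le_of_forall_pos_le_add fun δ hδ => ?_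
  obtain ⟨b, hb, hb1, hρ⟩ := exists_lt_re_apply ρ (half_pos hδ)
  obtain ⟨c, hc, hc1, hσ⟩ := exists_lt_re_apply σ (half_pos hδ)
  -- A common upper bound of the two near-maximizers nearly maximizes `ρ` and `σ` at once.
  obtain ⟨d, ⟨_, hd1⟩, hbd, hcd⟩ := CStarAlgebra.directedOn_nonneg_ball b ⟨hb, by simpa using hb1⟩
    c ⟨hc, by simpa using hc1⟩
  rw [mem_ball_zero_iff] at hd1
  have h1 := re_apply_mono ρ hbd
  have h2 := re_apply_mono σ hcd
  have h3 := re_apply_le_norm τ d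
  have h4 : ‖toDual τ‖ * ‖d‖ ≤ ‖toDual τ‖ := mul_le_of_le_one_right (norm_nonneg _) hd1.le
  have h5 : (τ d).re = (ρ d).re + (σ d).re := by rw [h]; simp
  linarith

end PositiveFunctionals

/-! ### Pure states attaining the norm of a positive element -/

section PureStates

variable {A : Type*} [NonUnitalCStarAlgebra A] [PartialOrder A] [StarOrderedRing A]

lemma locallyConvexSpace_weakDual {A : Type*} [NonUnitalCStarAlgebra A] : LocallyConvexSpace ℝ (WeakDual ℂ A) :=
  inferInstanceAs (LocallyConvexSpace ℝ (WeakBilin (topDualPairing ℂ A)))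

/-- Extreme points of a norm-exposed face of the dual unit ball are pure states. -/
lemma isPureState_of_mem_extremePoints {a : A} (ha1 : ‖a‖ ≤ 1) (ha : 0 ≤ a)
    {τ : A →ₚ[ℂ] ℂ} (hτ : toDual τ ∈
      Set.extremePoints ℝ {f : A →L[ℂ] ℂ | ‖f‖ ≤ 1 ∧ f a = 1}) : IsPureState τ := by
  obtain ⟨⟨hτ1, hτa⟩, hext⟩ := mem_extremePoints_iff_left.1 hτ
  have hle : ∀ ρ : A →ₚ[ℂ] ℂ, (ρ a).re ≤ ‖toDual ρ‖ := fun ρ =>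
    (re_apply_le_norm ρ a).trans (mul_le_of_le_one_right (norm_nonneg _) ha1)
  refine ⟨le_antisymm hτ1 ?_, fun ρ hρ => ?_⟩
  · have := hle τ
    rw [← toDual_apply, hτa] at this
    simpa using this
  -- Additivity of the norm, with `ρ a + σ a = 1`, forces `ρ` and `σ` to attain their norms at `a`.
  -- Normalized, they lie in the face, and `τ` is their convex combination; extremality gives `τ = ρ
  -- / ‖ρ‖`.
  let σ : A →ₚ[ℂ] ℂ := PositiveLinearMap.mk₀ (τ.toLinearMap - ρ.toLinearMap) fun b hb => by
    simpa using hρ b hb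
  have hσ : ∀ b, τ b = ρ b + σ b := fun b => by
    change τ b = ρ b + (τ b - ρ b); ring
  have hsum := norm_toDual_add_norm_toDual_le hσ
  have hsuma : (ρ a).re + (σ a).re = 1 := by
    rw [← Complex.add_re, ← hσ, ← toDual_apply, hτa, Complex.one_re]
  have hρa : (ρ a).re = ‖toDual ρ‖ := by linarith [hle ρ, hle σ]
  have hσa : (σ a).re = ‖toDual σ‖ := by linarith [hle ρ, hle σ]
  rcases (norm_nonneg (toDual ρ)).eq_or_lt with hs | hs
  · refine ⟨0, le_rfl, zero_le_one, fun b => ?_⟩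
    rw [← toDual_apply, norm_eq_zero.1 hs.symm]
    simp
  rcases (norm_nonneg (toDual σ)).eq_or_lt with hr | hr
  · refine ⟨1, zero_le_one, le_rfl, fun b => ?_⟩
    rw [hσ b, ← toDual_apply σ, norm_eq_zero.1 hr.symm]
    simp
  have hmem : ∀ κ : A →ₚ[ℂ] ℂ, 0 < ‖toDual κ‖ → (κ a).re = ‖toDual κ‖ →
      ‖toDual κ‖⁻¹ • toDual κ ∈ {f : A →L[ℂ] ℂ | ‖f‖ ≤ 1 ∧ f a = 1} := by
    intro κ h0 hκ
    refine ⟨by simp [norm_smul, h0.ne'], ?_⟩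
    rw [smul_apply, toDual_apply, ← ofReal_re_apply_of_nonneg κ ha, hκ,
      Complex.real_smul, ← Complex.ofReal_mul, inv_mul_cancel₀ h0.ne', Complex.ofReal_one]
  have key := hext _ (hmem ρ hs hρa) _ (hmem σ hr hσa)
    ⟨‖toDual ρ‖, ‖toDual σ‖, hs, hr, by linarith, by
      rw [smul_smul, smul_smul, mul_inv_cancel₀ hs.ne', mul_inv_cancel₀ hr.ne', one_smul, one_smul]
      ext b
      exact (hσ b).symm⟩
  refine ⟨‖toDual ρ‖, hs.le, by linarith, fun b => ?_⟩
  rw [← toDual_apply τ, ← key, smul_apply, Complex.real_smul, ← mul_assoc,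
    ← Complex.ofReal_mul, mul_inv_cancel₀ hs.ne', Complex.ofReal_one, one_mul, toDual_apply]

/-- The norm of a nonzero positive element is attained at a pure state. -/
theorem exists_pureState_apply_eq_norm {a : A} (ha : 0 ≤ a) (ha0 : a ≠ 0) :
    ∃ τ : PureState A, τ.1 a = ‖a‖ := by
  have hpos : 0 < ‖a‖ := norm_pos_iff.2 ha0
  set b : A := ‖a‖⁻¹ • a with hb
  have hb0 : 0 ≤ b := smul_nonneg (by positivity) ha
  have hb1 : ‖b‖ = 1 := by simp [hb, norm_smul, hpos.ne']
  have := locallyConvexSpace_weakDual (A := A)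
  let S : Set (WeakDual ℂ A) :=
    WeakDual.toStrongDual ⁻¹' Metric.closedBall (0 : StrongDual ℂ A) 1 ∩ {f | f b = 1}
  have hS : IsCompact S := (WeakDual.isCompact_closedBall 0 1).inter_right
    (isClosed_singleton.preimage (WeakDual.eval_continuous b))
  have hne : S.Nonempty := by
    obtain ⟨g, hg, hgb⟩ := exists_dual_vector'' ℂ b
    refine ⟨StrongDual.toWeakDual g, ?_, ?_⟩
    · simpa using hg
    · change g b = 1
      rw [hgb, hb1]; simp
  -- Krein–Milman in the weak-* topology.
  obtain ⟨φ, hφ⟩ := hS.extremePoints_nonempty hne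
  have hφ' : WeakDual.toStrongDual φ ∈ Set.extremePoints ℝ {f : A →L[ℂ] ℂ | ‖f‖ ≤ 1 ∧ f b = 1} := by
    have e : S = {f : A →L[ℂ] ℂ | ‖f‖ ≤ 1 ∧ f b = 1} := by
      ext f
      simp [S]
      rfl
    rw [← e]
    exact hφ
  let τ : A →ₚ[ℂ] ℂ := PositiveLinearMap.mk₀ (WeakDual.toStrongDual φ).toLinearMap fun c hc =>
    nonneg_of_apply_eq_one hφ'.1.1 hb0 hb1.le hφ'.1.2 hc
  have hτφ : toDual τ = WeakDual.toStrongDual φ := rfl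
  refine ⟨⟨τ, isPureState_of_mem_extremePoints hb1.le hb0 (hτφ ▸ hφ')⟩, ?_⟩
  have h1 : τ b = 1 := hφ'.1.2
  rw [hb, apply_real_smul] at h1
  have hc : ((‖a‖ : ℝ) : ℂ) ≠ 0 := by exact_mod_cast hpos.ne'
  change τ a = _
  push_cast at h1
  field_simp at h1
  exact h1

end PureStates

/-! ### Elementary bounds for the Hilbert multi-norm -/

section HilbertSpace

lemma IsProj.norm_le {H : Type*} [SeminormedAddCommGroup H] [InnerProductSpace ℂ H] {P : H → H}
    (hP : IsProj ℂ P) (x : H) : ‖P x‖ ≤ ‖x‖ := by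
  have h : ‖P x‖ ^ 2 ≤ ‖x‖ * ‖P x‖ := by
    rw [← inner_self_eq_norm_sq (𝕜 := ℂ), hP.selfAdjoint, hP.idempotent]
    exact (RCLike.re_le_norm _).trans (norm_inner_le_norm _ _)
  nlinarith [norm_nonneg (P x), norm_nonneg x]

variable {H : Type*} [NormedAddCommGroup H] [InnerProductSpace ℂ H] {n : ℕ}

lemma IsProjFamily.norm_sum_le {P : Fin n → H → H} (hP : IsProjFamily ℂ P) (x : Fin n → H) :
    ‖∑ i, P i (x i)‖ ≤ ∑ i, ‖x i‖ :=
  norm_sum_le_of_le _ fun i _ => (hP.isProj i).norm_le (x i)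

lemma hilbertMultiNorm_nonneg {R E : Type*} [NormedAddCommGroup E] [Inner R E] (x : Fin n → E) :
    0 ≤ hilbertMultiNorm R x :=
  Real.sSup_nonneg (by rintro _ ⟨P, -, rfl⟩; exact norm_nonneg _)

lemma hilbertMultiNorm_le_sum_norm (x : Fin n → H) : hilbertMultiNorm ℂ x ≤ ∑ i, ‖x i‖ := by
  refine Real.sSup_le ?_ (by positivity)
  rintro _ ⟨P, hP, rfl⟩
  exact hP.norm_sum_le x

lemma IsProjFamily.norm_sum_le_hilbertMultiNorm {P : Fin n → H → H} (hP : IsProjFamily ℂ P)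
    (x : Fin n → H) : ‖∑ i, P i (x i)‖ ≤ hilbertMultiNorm ℂ x := by
  refine le_csSup ⟨∑ i, ‖x i‖, ?_⟩ ⟨P, hP, rfl⟩
  rintro _ ⟨Q, hQ, rfl⟩
  exact hQ.norm_sum_le x

end HilbertSpace

/-! ### Passing projections to `H_τ` and inequality (2) -/

section GNS

variable {A E : Type*} [NonUnitalCStarAlgebra A] [PartialOrder A] [StarOrderedRing A]
  [NormedAddCommGroup E] [NormedSpace ℂ E] [SMul Aᵐᵒᵖ E] [CStarModule Aᵐᵒᵖ E] {n : ℕ}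

lemma norm_gnsClass_sq (τ : A →ₚ[ℂ] ℂ) (x : E) :
    ‖gnsClass τ x‖ ^ 2 = (τ (rinner A x x)).re := by
  rw [← inner_self_eq_norm_sq (𝕜 := ℂ), gnsClass_inner]
  rfl

lemma norm_gnsClass_le (τ : PureState A) (x : E) : ‖gnsClass τ.1 x‖ ≤ ‖x‖ := by
  refine (pow_le_pow_iff_left₀ (norm_nonneg _) (norm_nonneg _) two_ne_zero).1 ?_
  rw [norm_gnsClass_sq, norm_sq_eq_norm_rinner_self (A := A)]
  have := re_apply_le_norm τ.1 (rinner A x x)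
  rwa [τ.2.norm_eq_one, one_mul] at this

lemma hilbertMultiNorm_gnsClass_le_pureNorm (τ : PureState A) (x : Fin n → E) :
    hilbertMultiNorm ℂ (fun i => gnsClass τ.1 (x i)) ≤ pureNorm A x := by
  refine le_ciSup (f := fun τ : PureState A => hilbertMultiNorm ℂ (fun i => gnsClass τ.1 (x i)))
    ⟨∑ i, ‖x i‖, ?_⟩ τ
  rintro _ ⟨σ, rfl⟩
  exact (hilbertMultiNorm_le_sum_norm _).trans
    (Finset.sum_le_sum fun i _ => norm_gnsClass_le σ (x i))

lemma pureNorm_nonneg (x : Fin n → E) : 0 ≤ pureNorm A x :=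
  Real.iSup_nonneg fun _ => hilbertMultiNorm_nonneg _

/-- The map induced by a projection on the semi-inner product space of a positive functional. -/
def IsProj.preGNSMap (τ : A →ₚ[ℂ] ℂ) {P : E → E} (hP : IsProj Aᵐᵒᵖ P) :
    PreGNS τ E →L[ℂ] PreGNS τ E :=
  LinearMap.mkContinuous
    { toFun := fun v => toPreGNS τ E (P ((toPreGNS τ E).symm v))
      map_add' := fun v w => by simp [hP.map_add]
      map_smul' := fun c v => by simp [hP.map_smul] } 1 fun v => by
    rw [one_mul]
    refine IsProj.norm_le (P := fun v => toPreGNS τ E (P ((toPreGNS τ E).symm v))) ?_ v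
    refine ⟨fun v w => ?_, fun v => by simp [hP.idempotent]⟩
    exact congrArg τ (hP.rinner_left ((toPreGNS τ E).symm v) ((toPreGNS τ E).symm w))

/-- The map induced by a projection on the Hilbert space of a positive functional. -/
def IsProj.gnsMap (τ : A →ₚ[ℂ] ℂ) {P : E → E} (hP : IsProj Aᵐᵒᵖ P) :
    GNSSpace τ E →L[ℂ] GNSSpace τ E :=
  (hP.preGNSMap τ).completion

lemma IsProj.gnsMap_gnsClass (τ : A →ₚ[ℂ] ℂ) {P : E → E} (hP : IsProj Aᵐᵒᵖ P) (x : E) :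
    hP.gnsMap τ (gnsClass τ x) = gnsClass τ (P x) :=
  UniformSpace.Completion.map_coe (hP.preGNSMap τ).uniformContinuous _

lemma gnsClass_induction (τ : A →ₚ[ℂ] ℂ) {p : GNSSpace τ E → Prop} (hp : IsClosed {w | p w})
    (h : ∀ x : E, p (gnsClass τ x)) (w : GNSSpace τ E) : p w :=
  UniformSpace.Completion.induction_on w hp h

lemma gnsClass_sum (τ : A →ₚ[ℂ] ℂ) {ι : Type*} (s : Finset ι) (x : ι → E) :
    gnsClass τ (∑ i ∈ s, x i) = ∑ i ∈ s, gnsClass τ (x i) := by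
  simp only [gnsClass, map_sum]
  exact map_sum (UniformSpace.Completion.toComplL (𝕜 := ℂ) (E := PreGNS τ E)) _ _

lemma gnsClass_zero (τ : A →ₚ[ℂ] ℂ) : gnsClass τ (0 : E) = 0 := by
  simpa using gnsClass_sum τ ∅ (fun i : Fin 0 => (0 : E))

lemma IsProjFamily.gnsMap (τ : A →ₚ[ℂ] ℂ) {P : Fin n → E → E} (hP : IsProjFamily Aᵐᵒᵖ P) :
    IsProjFamily ℂ fun i => ⇑((hP.isProj i).gnsMap τ) where
  isProj i := by
    refine ⟨fun v w => ?_, fun v => ?_⟩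
    · induction v using gnsClass_induction with
      | hp => exact isClosed_eq (by fun_prop) (by fun_prop)
      | h x =>
        induction w using gnsClass_induction with
        | hp => exact isClosed_eq (by fun_prop) (by fun_prop)
        | h y =>
          rw [IsProj.gnsMap_gnsClass, IsProj.gnsMap_gnsClass, gnsClass_inner, gnsClass_inner,
            (hP.isProj i).rinner_left]
    · induction v using gnsClass_induction with
      | hp => exact isClosed_eq (by fun_prop) (by fun_prop)
      | h y => rw [IsProj.gnsMap_gnsClass, IsProj.gnsMap_gnsClass, (hP.isProj i).idempotent]
  orthogonal i j hij v := by
    induction v using gnsClass_induction with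
    | hp => exact isClosed_eq (by fun_prop) (by fun_prop)
    | h y =>
      rw [IsProj.gnsMap_gnsClass, IsProj.gnsMap_gnsClass, hP.orthogonal i j hij, gnsClass_zero]
  sum_eq v := by
    induction v using gnsClass_induction with
    | hp => exact isClosed_eq (by fun_prop) (by fun_prop)
    | h y =>
      simp only [IsProj.gnsMap_gnsClass]
      rw [← gnsClass_sum, hP.sum_eq]

theorem hilbertMultiNorm_le_pureNorm (x : Fin n → E) :
    hilbertMultiNorm Aᵐᵒᵖ x ≤ pureNorm A x := by
  refine Real.sSup_le ?_ (pureNorm_nonneg x)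
  rintro _ ⟨P, hP, rfl⟩
  set z := ∑ i, P i (x i)
  rcases eq_or_ne (rinner A z z) 0 with h0 | h0
  · rw [norm_eq_sqrt_norm_rinner_self (A := A), h0]
    simpa using pureNorm_nonneg x
  obtain ⟨τ, hτ⟩ := exists_pureState_apply_eq_norm (rinner_self_nonneg (A := A) z) h0
  have hz : ‖z‖ = ‖gnsClass τ.1 z‖ := by
    refine (pow_left_inj₀ (norm_nonneg _) (norm_nonneg _) two_ne_zero).1 ?_
    rw [norm_gnsClass_sq, hτ, norm_sq_eq_norm_rinner_self (A := A), Complex.ofReal_re]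
  have hsum : gnsClass τ.1 z = ∑ i, (hP.isProj i).gnsMap τ.1 (gnsClass τ.1 (x i)) := by
    simp only [IsProj.gnsMap_gnsClass]
    exact gnsClass_sum _ _ _
  rw [hz, hsum]
  exact ((hP.gnsMap τ.1).norm_sum_le_hilbertMultiNorm _).trans
    (hilbertMultiNorm_gnsClass_le_pureNorm τ x)

end GNS

/-- A selfadjoint contraction is the real part of a unitary. -/
lemma exists_unitary_add_star_eq {B : Type*} [CStarAlgebra B] [PartialOrder B] [StarOrderedRing B]
    {a : B} (ha : IsSelfAdjoint a) (ha1 : ‖a‖ ≤ 1) :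
    ∃ w : unitary B, (w : B) + star (w : B) = (2 : ℂ) • a := by
  refine ⟨⟨_, ha.self_add_I_smul_cfcSqrt_sub_sq_mem_unitary a ha1⟩, ?_⟩
  simp only [star_add, star_smul, ha.star_eq, (CFC.sqrt_nonneg (1 - a ^ 2)).isSelfAdjoint.star_eq,
    RCLike.star_def, Complex.conj_I]
  module

/-! ### The dual expression in a Hilbert space of dimension at least `n` -/

section HilbertSpace

variable {H : Type*} [NormedAddCommGroup H] [InnerProductSpace ℂ H] {n : ℕ}

/-- The projection onto `g i`, enlarged for `i = 0` by the complement of the span of `g`. -/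
def orthonormalProj {n : ℕ} (g : Fin (n + 1) → H) (i : Fin (n + 1)) (w : H) : H :=
  inner ℂ (g i) w • g i + if i = 0 then w - ∑ j, inner ℂ (g j) w • g j else 0

lemma inner_orthonormalProj {g : Fin (n + 1) → H} (hg : Orthonormal ℂ g) (i j : Fin (n + 1))
    (w : H) : inner ℂ (g j) (orthonormalProj g i w) = if j = i then inner ℂ (g j) w else 0 := by
  have h := orthonormal_iff_ite.1 hg
  unfold orthonormalProj
  split_ifs with h1 h2 h2
  · simp [h, h2, hg.1]
  · simp [h, h2]
  · simp [h2, hg.1]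
  · simp [h, h2]

lemma isProjFamily_orthonormalProj {g : Fin (n + 1) → H} (hg : Orthonormal ℂ g) :
    IsProjFamily ℂ (orthonormalProj g) where
  isProj i := by
    refine ⟨fun v w => ?_, fun w => ?_⟩
    · unfold orthonormalProj
      split_ifs
      · simp only [inner_add_left, inner_add_right, inner_smul_left, inner_smul_right,
          inner_sub_left, inner_sub_right, sum_inner, inner_sum, inner_conj_symm]
        congr 1
        · ring
        · congr 1
          exact Finset.sum_congr rfl fun _ _ => by ring
      · simp only [inner_add_left, inner_add_right, inner_smul_left, inner_smul_right,
          inner_conj_symm, inner_zero_left, inner_zero_right]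
        ring
    · rw [orthonormalProj]
      simp only [inner_orthonormalProj hg, if_true]
      conv_rhs => rw [orthonormalProj]
      congr 1
      split_ifs with h
      · rw [orthonormalProj, if_pos h]
        simp
      · rfl
  orthogonal i j hij w := by
    rw [orthonormalProj]
    simp only [inner_orthonormalProj hg, if_neg hij]
    split_ifs with h
    · have hj : j ≠ 0 := fun hj => hij (h.trans hj.symm)
      rw [orthonormalProj, if_neg hj]
      simp
    · simp
  sum_eq w := by
    simp [orthonormalProj, Finset.sum_add_distrib]

/-- The coefficient of `∑ P j (x j)` along `g i` is that of `x i`, so Bessel's inequality applies.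
-/
lemma sum_norm_inner_sq_le_of_orthonormal {g : Fin n → H} (hg : Orthonormal ℂ g) (x : Fin n → H) :
    ∑ i, ‖inner ℂ (g i) (x i)‖ ^ 2 ≤ hilbertMultiNorm ℂ x ^ 2 := by
  cases n with
  | zero => simpa using sq_nonneg _
  | succ n =>
    calc ∑ i, ‖inner ℂ (g i) (x i)‖ ^ 2
        = ∑ i, ‖inner ℂ (g i) (∑ j, orthonormalProj g j (x j))‖ ^ 2 := by
          simp [inner_orthonormalProj hg]
      _ ≤ ‖∑ j, orthonormalProj g j (x j)‖ ^ 2 := hg.sum_inner_products_le _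
      _ ≤ _ := pow_le_pow_left₀ (norm_nonneg _)
        ((isProjFamily_orthonormalProj hg).norm_sum_le_hilbertMultiNorm x) 2

variable [CompleteSpace H]

local notation "ℓ²" n => EuclideanSpace ℂ (Fin n)

open ContinuousLinearMap in
lemma sum_norm_inner_sq_le_of_adjoint_comp_eq_one {G : (ℓ² n) →L[ℂ] H}
    (hG : adjoint G ∘L G = 1) (x : Fin n → H) :
    ∑ i, ‖inner ℂ (G (EuclideanSpace.single i 1)) (x i)‖ ^ 2 ≤ hilbertMultiNorm ℂ x ^ 2 := by
  refine sum_norm_inner_sq_le_of_orthonormal (g := fun i => G (EuclideanSpace.single i 1)) ?_ x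
  rw [orthonormal_iff_ite]
  intro i j
  rw [← adjoint_inner_right, ← comp_apply, hG]
  exact orthonormal_iff_ite.1 (EuclideanSpace.orthonormal_single (𝕜 := ℂ)) i j

open ContinuousLinearMap in
/-- By polar decomposition, an injective operator `T` on `ℂⁿ` is `‖T‖ / 2` times the sum of two
isometries. -/
lemma sum_norm_inner_sq_le_of_injective {T : (ℓ² n) →L[ℂ] H} (hT : Function.Injective T)
    (x : Fin n → H) :
    ∑ i, ‖inner ℂ (T (EuclideanSpace.single i 1)) (x i)‖ ^ 2 ≤
      ‖T‖ ^ 2 * hilbertMultiNorm ℂ x ^ 2 := by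
  rcases eq_or_ne T 0 with rfl | hT0
  · simp
  have hpos : 0 < ‖T‖ := norm_pos_iff.2 hT0
  set S : (ℓ² n) →L[ℂ] (ℓ² n) := adjoint T ∘L T with hS
  have hS0 : 0 ≤ S := by
    rw [nonneg_iff_isPositive]
    exact isPositive_adjoint_comp_self T
  have hSu : IsUnit S := by
    rw [isUnit_iff_isUnit_toLinearMap, LinearMap.isUnit_iff_ker_eq_bot]
    exact (ker_adjoint_comp_self T).trans (LinearMap.ker_eq_bot.2 hT)
  set R := CFC.sqrt S with hR
  have hRsa : star R = R := (CFC.sqrt_nonneg S).isSelfAdjoint.star_eq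
  have hRR : R * R = S := CFC.sqrt_mul_sqrt_self S hS0
  obtain ⟨r, hr⟩ := (CFC.isUnit_sqrt_iff S hS0).2 hSu
  have hRn : ‖R‖ = ‖T‖ := by
    refine (mul_self_inj (norm_nonneg _) (norm_nonneg _)).1 ?_
    rw [← CStarRing.norm_star_mul_self, hRsa, hRR, hS, norm_adjoint_comp_self]
  have hrR : (↑r⁻¹ : (ℓ² n) →L[ℂ] (ℓ² n)) * R = 1 := by rw [hR, ← hr]; exact r.inv_mul
  have hRr : R * (↑r⁻¹ : (ℓ² n) →L[ℂ] (ℓ² n)) = 1 := by rw [hR, ← hr]; exact r.mul_inv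
  set Q : (ℓ² n) →L[ℂ] (ℓ² n) := ↑r⁻¹
  have hQR : star Q * R = 1 := by
    have := congrArg star hRr
    rwa [star_mul, hRsa, star_one] at this
  -- The isometric factor `T |T|⁻¹` of the polar decomposition.
  set U : (ℓ² n) →L[ℂ] H := T ∘L Q with hU
  have hUU : adjoint U ∘L U = 1 := by
    calc adjoint U ∘L U = star Q * S * Q := by
          rw [hU, adjoint_comp]; rfl
      _ = (star Q * R) * (R * Q) := by rw [← hRR]; simp only [mul_assoc]
      _ = 1 := by rw [hQR, hRr, one_mul]
  have hTU : T = U ∘L R := by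
    calc T = T ∘L (Q * R) := by rw [hrR]; rfl
      _ = _ := rfl
  have hUW : ∀ W ∈ unitary ((ℓ² n) →L[ℂ] (ℓ² n)), adjoint (U ∘L W) ∘L (U ∘L W) = 1 := by
    intro W hW
    calc adjoint (U ∘L W) ∘L (U ∘L W) = star W * (adjoint U ∘L U) * W := by
          rw [adjoint_comp]; rfl
      _ = 1 := by rw [hUU, mul_one]; exact (Unitary.mem_iff.1 hW).1
  have hc : (‖T‖ : ℂ) ≠ 0 := by exact_mod_cast hpos.ne'
  obtain ⟨W, hW⟩ : ∃ W : unitary ((ℓ² n) →L[ℂ] (ℓ² n)),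
      (W : (ℓ² n) →L[ℂ] (ℓ² n)) + star (W : (ℓ² n) →L[ℂ] (ℓ² n)) =
        (2 : ℂ) • ((‖T‖ : ℂ)⁻¹ • R) := by
    refine exists_unitary_add_star_eq ?_ ?_
    · rw [IsSelfAdjoint, star_smul, hRsa, star_inv₀, RCLike.star_def, Complex.conj_ofReal]
    · rw [norm_smul, norm_inv, Complex.norm_real, norm_norm, hRn, inv_mul_cancel₀ hpos.ne']
  have hWR : R = ((‖T‖ : ℂ) / 2) •
      ((W : (ℓ² n) →L[ℂ] (ℓ² n)) + star (W : (ℓ² n) →L[ℂ] (ℓ² n))) := by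
    rw [hW, smul_smul, smul_smul, div_mul_cancel₀ _ two_ne_zero, mul_inv_cancel₀ hc, one_smul]
  have h1 := sum_norm_inner_sq_le_of_adjoint_comp_eq_one (hUW _ W.2) x
  have h2 := sum_norm_inner_sq_le_of_adjoint_comp_eq_one (hUW _ (star W).2) x
  -- Convexity of the square, for `T = (‖T‖ / 2) (U W + U W⋆)`.
  have hi : ∀ i, ‖inner ℂ (T (EuclideanSpace.single i 1)) (x i)‖ ^ 2 ≤ ‖T‖ ^ 2 / 2 *
      (‖inner ℂ ((U ∘L (W : (ℓ² n) →L[ℂ] (ℓ² n))) (EuclideanSpace.single i 1)) (x i)‖ ^ 2 +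
      ‖inner ℂ ((U ∘L ((star W : unitary _) : (ℓ² n) →L[ℂ] (ℓ² n)))
        (EuclideanSpace.single i 1)) (x i)‖ ^ 2) := by
    intro i
    set a := inner ℂ ((U ∘L (W : (ℓ² n) →L[ℂ] (ℓ² n))) (EuclideanSpace.single i 1)) (x i) with ha
    set b := inner ℂ ((U ∘L ((star W : unitary _) : (ℓ² n) →L[ℂ] (ℓ² n)))
        (EuclideanSpace.single i 1)) (x i) with hb
    have e : inner ℂ (T (EuclideanSpace.single i 1)) (x i) = ((‖T‖ : ℂ) / 2) * (a + b) := by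
      rw [ha, hb, ← inner_add_left]
      conv_lhs => rw [hTU, hWR]
      simp [inner_add_left]
      ring
    rw [e, norm_mul, mul_pow, norm_div, Complex.norm_real, norm_norm]
    have h3 := norm_add_le a b
    have h4 : ‖a + b‖ ^ 2 ≤ 2 * (‖a‖ ^ 2 + ‖b‖ ^ 2) := by
      nlinarith [sq_nonneg (‖a‖ - ‖b‖), norm_nonneg (a + b), norm_nonneg a, norm_nonneg b]
    calc (‖T‖ / ‖(2 : ℂ)‖) ^ 2 * ‖a + b‖ ^ 2 ≤ (‖T‖ / 2) ^ 2 * (2 * (‖a‖ ^ 2 + ‖b‖ ^ 2)) := by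
          rw [show ‖(2 : ℂ)‖ = 2 by simp]; gcongr
      _ = _ := by ring
  calc _ ≤ _ := Finset.sum_le_sum fun i _ => hi i
    _ = _ := by rw [← Finset.mul_sum, Finset.sum_add_distrib]
    _ ≤ ‖T‖ ^ 2 / 2 * (hilbertMultiNorm ℂ x ^ 2 + hilbertMultiNorm ℂ x ^ 2) := by gcongr
    _ = _ := by ring

open ContinuousLinearMap Filter in
-- With `J` the isometry `e_i ↦ u i`, one has `J⋆ (T - c J) = J⋆ T - c`, so `T - c J` is injective
-- off a finite spectrum. Apply the injective case and let `c → 0`, `c ≠ 0`.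
lemma sum_norm_inner_sq_le_of_orthonormal_exists {u : Fin n → H} (hu : Orthonormal ℂ u)
    (T : (ℓ² n) →L[ℂ] H) (x : Fin n → H) :
    ∑ i, ‖inner ℂ (T (EuclideanSpace.single i 1)) (x i)‖ ^ 2 ≤
      ‖T‖ ^ 2 * hilbertMultiNorm ℂ x ^ 2 := by
  let J : (ℓ² n) →L[ℂ] H := LinearMap.toContinuousLinearMap
    ((Fintype.linearCombination ℂ u).comp (WithLp.linearEquiv 2 ℂ (Fin n → ℂ)).toLinearMap)
  have hJ : adjoint J ∘L J = 1 := by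
    ext1 v
    refine ext_inner_left ℂ fun w => ?_
    rw [comp_apply, adjoint_inner_right]
    simp [J, Fintype.linearCombination_apply, hu.inner_sum, PiLp.inner_apply, mul_comm]
  have hinj : ∀ c : ℂ, c ∉ spectrum ℂ (adjoint J ∘L T) → Function.Injective (T - c • J) := by
    intro c hc
    rw [spectrum.notMem_iff] at hc
    obtain ⟨q, hq⟩ := hc
    have e : (-(↑q⁻¹ : (ℓ² n) →L[ℂ] (ℓ² n))) ∘L (adjoint J ∘L (T - c • J)) = 1 := by
      have : adjoint J ∘L (T - c • J) = -(q : (ℓ² n) →L[ℂ] (ℓ² n)) := by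
        rw [hq, comp_sub, comp_smul, hJ, Algebra.algebraMap_eq_smul_one, neg_sub]
      rw [this]
      calc _ = (↑q⁻¹ : (ℓ² n) →L[ℂ] (ℓ² n)) * ↑q := by
            rw [neg_comp, comp_neg, neg_neg]; rfl
        _ = 1 := q.inv_mul
    refine Function.LeftInverse.injective
      (g := fun h => (-(↑q⁻¹ : (ℓ² n) →L[ℂ] (ℓ² n))) (adjoint J h)) fun v => ?_
    exact congrArg (fun F : (ℓ² n) →L[ℂ] (ℓ² n) => F v) e
  have hfin : (spectrum ℂ (adjoint J ∘L T)).Finite := by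
    have := Module.End.finite_spectrum ((adjoint J ∘L T : (ℓ² n) →L[ℂ] (ℓ² n)) : (ℓ² n) →ₗ[ℂ] (ℓ² n))
    rwa [← ContinuousLinearMap.spectrum_eq] at this
  have hev : ∀ᶠ c in nhdsWithin (0 : ℂ) {0}ᶜ, c ∉ spectrum ℂ (adjoint J ∘L T) := by
    have h1 : ∀ᶠ c in nhds (0 : ℂ), c ∈ (spectrum ℂ (adjoint J ∘L T) \ {0})ᶜ :=
      (hfin.subset Set.sdiff_subset).isClosed.isOpen_compl.mem_nhds (by simp)
    filter_upwards [h1.filter_mono nhdsWithin_le_nhds, self_mem_nhdsWithin] with c hc hc0 hmem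
    exact hc ⟨hmem, hc0⟩
  have hl : Tendsto (fun c : ℂ => ∑ i,
      ‖inner ℂ ((T - c • J) (EuclideanSpace.single i 1)) (x i)‖ ^ 2) (nhdsWithin 0 {0}ᶜ)
      (nhds (∑ i, ‖inner ℂ (T (EuclideanSpace.single i 1)) (x i)‖ ^ 2)) := by
    refine Tendsto.mono_left ?_ nhdsWithin_le_nhds
    have : Continuous fun c : ℂ => ∑ i,
      ‖inner ℂ ((T - c • J) (EuclideanSpace.single i 1)) (x i)‖ ^ 2 := by
      simp only [sub_apply, smul_apply]
      fun_prop
    simpa using this.tendsto 0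
  have hr : Tendsto (fun c : ℂ => ‖T - c • J‖ ^ 2 * hilbertMultiNorm ℂ x ^ 2) (nhdsWithin 0 {0}ᶜ)
      (nhds (‖T‖ ^ 2 * hilbertMultiNorm ℂ x ^ 2)) := by
    refine Tendsto.mono_left ?_ nhdsWithin_le_nhds
    have : Continuous fun c : ℂ => ‖T - c • J‖ ^ 2 * hilbertMultiNorm ℂ x ^ 2 := by fun_prop
    simpa using this.tendsto 0
  exact le_of_tendsto_of_tendsto hl hr
    (hev.mono fun c hc => sum_norm_inner_sq_le_of_injective (hinj c hc) x)

/-- In a Hilbert space of dimension at least `n`, the Hilbert multi-norm dominates the dual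
expression over all `y` with `∑ᵢ |⟨yᵢ, w⟩|² ≤ ‖w‖²`. -/
theorem sum_norm_inner_sq_le_hilbertMultiNorm_sq (hn : (n : Cardinal) ≤ oDim H) (x y : Fin n → H)
    (hy : ∀ w, ∑ i, ‖inner ℂ (y i) w‖ ^ 2 ≤ ‖w‖ ^ 2) :
    ∑ i, ‖inner ℂ (y i) (x i)‖ ^ 2 ≤ hilbertMultiNorm ℂ x ^ 2 := by
  obtain ⟨b, hb⟩ := (exists_hilbertBasis ℂ H).choose_spec
  obtain ⟨f⟩ : Nonempty (Fin n ↪ ↥(exists_hilbertBasis ℂ H).choose) := by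
    rw [← Cardinal.lift_mk_le']
    simpa [oDim] using hn
  have hu : Orthonormal ℂ (fun i => b (f i)) := b.orthonormal.comp f f.injective
  let T : (ℓ² n) →L[ℂ] H := LinearMap.toContinuousLinearMap
    ((Fintype.linearCombination ℂ y).comp (WithLp.linearEquiv 2 ℂ (Fin n → ℂ)).toLinearMap)
  have hTy : ∀ i, T (EuclideanSpace.single i 1) = y i := fun i => by
    simp [T, Fintype.linearCombination_apply, Pi.single_apply]
  -- The assumed inequality says exactly that the adjoint, with coordinates `⟨y i, w⟩`, is a
  -- contraction.
  have hT1 : ‖T‖ ≤ 1 := by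
    rw [← ContinuousLinearMap.adjoint.norm_map T]
    refine ContinuousLinearMap.opNorm_le_bound _ zero_le_one fun w => ?_
    rw [one_mul, EuclideanSpace.norm_eq, ← Real.sqrt_sq (norm_nonneg w)]
    refine Real.sqrt_le_sqrt (le_trans (le_of_eq ?_) (hy w))
    refine Finset.sum_congr rfl fun i _ => ?_
    rw [← hTy i, ← ContinuousLinearMap.adjoint_inner_right, EuclideanSpace.inner_single_left]
    simp
  have h := sum_norm_inner_sq_le_of_orthonormal_exists hu T x
  simp only [hTy] at h
  exact h.trans (mul_le_of_le_one_left (sq_nonneg _) (pow_le_one₀ (norm_nonneg _) hT1))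

end HilbertSpace

/-! ### Multiplicativity of pure states and inequality (3) -/

section Commutative

variable {A : Type*} [NonUnitalCStarAlgebra A] [PartialOrder A] [StarOrderedRing A]

/-- A multiple of a positive element by a commuting positive contraction is smaller. -/
lemma mul_le_self_of_commute {a b : A} (ha : 0 ≤ a) (hb : 0 ≤ b) (hb1 : ‖b‖ ≤ 1)
    (h : Commute (CFC.sqrt a) b) : a * b ≤ a := by
  have hs : star (CFC.sqrt a) = CFC.sqrt a := (CFC.sqrt_nonneg a).isSelfAdjoint.star_eq
  have hss : CFC.sqrt a * CFC.sqrt a = a := CFC.sqrt_mul_sqrt_self a ha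
  have key := CStarAlgebra.star_left_conjugate_le_norm_smul (a := CFC.sqrt a) (b := b)
    hb.isSelfAdjoint
  rw [hs, mul_assoc, ← h.eq, ← mul_assoc, hss] at key
  refine key.trans ?_
  calc ‖b‖ • a ≤ (1 : ℝ) • a := smul_le_smul_of_nonneg_right hb1 ha
    _ = a := one_smul _ _

open Filter in
-- The approximate unit eventually dominates any near-maximizer of `τ` in the positive open ball.
lemma tendsto_apply_approximateUnit {τ : A →ₚ[ℂ] ℂ} (hτ : ‖toDual τ‖ = 1) :
    Tendsto τ (CStarAlgebra.approximateUnit A) (nhds 1) := by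
  have hl := CStarAlgebra.increasingApproximateUnit A
  have hre : Tendsto (fun e => (τ e).re) (CStarAlgebra.approximateUnit A) (nhds 1) := by
    rw [Metric.tendsto_nhds]
    intro δ hδ
    obtain ⟨c, hc, hc1, hcτ⟩ := exists_lt_re_apply τ hδ
    have hev : ∀ᶠ e in CStarAlgebra.approximateUnit A, c ≤ e :=
      (CStarAlgebra.hasBasis_approximateUnit A).eventually_iff.2 ⟨c, ⟨hc, hc1⟩, fun _ he => he.1⟩
    filter_upwards [hev, hl.eventually_norm] with e he he1
    have h1 := re_apply_mono τ he
    have h2 := re_apply_le_norm τ e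
    rw [hτ] at h2 hcτ
    rw [Real.dist_eq, abs_lt]
    constructor <;> linarith
  have hc := (Complex.continuous_ofReal.tendsto 1).comp hre
  rw [Complex.ofReal_one] at hc
  refine hc.congr' ?_
  filter_upwards [hl.eventually_nonneg] with e he
  exact ofReal_re_apply_of_nonneg τ he

/-- Pure states of a commutative C⋆-algebra are multiplicative. -/
lemma IsPureState.map_mul {τ : A →ₚ[ℂ] ℂ} (hτ : IsPureState τ) (hA : ∀ a b : A, a * b = b * a)
    (a b : A) : τ (a * b) = τ a * τ b := by
  have key : ∀ b : A, 0 ≤ b → ‖b‖ ≤ 1 → ∀ a, τ (a * b) = τ a * τ b := by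
    intro b hb hb1
    -- For a positive contraction `b`, `a ↦ τ (a b)` is dominated by `τ`, hence equals `t τ`; an
    -- approximate unit identifies `t = τ b`. Such `b` span `A`.
    let ρ : A →ₚ[ℂ] ℂ := PositiveLinearMap.mk₀
      (τ.toLinearMap ∘ₗ LinearMap.mulRight ℂ b) fun a ha =>
        τ.map_nonneg (Commute.mul_nonneg ha hb (hA a b))
    obtain ⟨t, -, -, ht⟩ := hτ.minimal ρ fun a ha =>
      OrderHomClass.mono τ (mul_le_self_of_commute ha hb hb1 (hA _ _))
    have ht' : ∀ a, τ (a * b) = t * τ a := ht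
    have h1 : Filter.Tendsto (fun e => τ (e * b)) (CStarAlgebra.approximateUnit A)
        (nhds (τ b)) :=
      ((toDual τ).continuous.tendsto b).comp
        ((CStarAlgebra.increasingApproximateUnit A).tendsto_mul_right b)
    have h2 : Filter.Tendsto (fun e => τ (e * b)) (CStarAlgebra.approximateUnit A)
        (nhds (t * 1)) := by
      simp only [ht']
      exact (tendsto_apply_approximateUnit hτ.norm_eq_one).const_mul _
    intro a
    rw [ht', tendsto_nhds_unique h1 h2]
    ring
  have hb : b ∈ Submodule.span ℂ ({x : A | 0 ≤ x} ∩ Metric.closedBall 0 1) := by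
    simp [CStarAlgebra.span_nonneg_inter_unitClosedBall]
  induction hb using Submodule.span_induction with
  | mem b hb => exact key b hb.1 (by simpa using hb.2) a
  | zero => simp
  | add b c _ _ hb hc => simp [mul_add, hb, hc]
  | smul r b _ hb => rw [mul_smul_comm, map_smul, map_smul, hb, smul_eq_mul, smul_eq_mul]; ring

lemma IsPureState.map_absSq {τ : A →ₚ[ℂ] ℂ} (hτ : IsPureState τ) (hA : ∀ a b : A, a * b = b * a)
    (a : A) : τ (absSq a) = ((‖τ a‖ ^ 2 : ℝ) : ℂ) := by
  rw [absSq, hτ.map_mul hA, map_star τ, RCLike.star_def, Complex.conj_mul', Complex.ofReal_pow]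

lemma IsPureState.re_map_sum_absSq {τ : A →ₚ[ℂ] ℂ} (hτ : IsPureState τ)
    (hA : ∀ a b : A, a * b = b * a) {ι : Type*} (s : Finset ι) (a : ι → A) :
    (τ (∑ i ∈ s, absSq (a i))).re = ∑ i ∈ s, ‖τ (a i)‖ ^ 2 := by
  rw [map_sum]
  simp only [hτ.map_absSq hA, ← Complex.ofReal_sum, Complex.ofReal_re]

/-- The left factor is the square root of `c`, as `regInvSqrt ε t * (t + ε) = √t`. In this algebraic
form a multiplicative `τ` determines `|τ (cfcₙ (regInvSqrt ε) c)|` directly. -/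
lemma regInvSqrt_mul_add_mul_self {ε : ℝ} (hε : 0 < ε) {c : A} (hc : 0 ≤ c) :
    (cfcₙ (regInvSqrt ε) c * c + ε • cfcₙ (regInvSqrt ε) c) *
      (cfcₙ (regInvSqrt ε) c * c + ε • cfcₙ (regInvSqrt ε) c) = c := by
  have hf := continuous_regInvSqrt hε
  have h : cfcₙ (regInvSqrt ε) c * c + ε • cfcₙ (regInvSqrt ε) c =
      cfcₙ (fun t => regInvSqrt ε t * t + ε * regInvSqrt ε t) c := by
    rw [cfcₙ_add (fun t => regInvSqrt ε t * t) (fun t => ε * regInvSqrt ε t) c,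
      cfcₙ_mul (regInvSqrt ε) (fun t => t) c, cfcₙ_const_mul ε (regInvSqrt ε) c, cfcₙ_id' ℝ c]
  rw [h, ← cfcₙ_mul (fun t => regInvSqrt ε t * t + ε * regInvSqrt ε t)
    (fun t => regInvSqrt ε t * t + ε * regInvSqrt ε t) c]
  conv_rhs => rw [← cfcₙ_id' ℝ c]
  refine cfcₙ_congr fun t ht => ?_
  have ht0 : 0 ≤ t := quasispectrum_nonneg_of_nonneg c hc t ht
  have e : regInvSqrt ε t * t + ε * regInvSqrt ε t = √t := by
    rw [regInvSqrt, abs_of_nonneg ht0]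
    field_simp
  simp only [e]
  exact Real.mul_self_sqrt ht0

variable {E : Type*} [NormedAddCommGroup E] [NormedSpace ℂ E] [SMul Aᵐᵒᵖ E] [CStarModule Aᵐᵒᵖ E]
  {n : ℕ}

/-- The constraint refers to the norm of `E`, not that of `H_τ`, so it is tested at `normalize A ε
z`. With `s` the left side and `t` the right side, `τ` turns it into `s t ≤ (t + ε)²`; then `ε → 0`.
-/
lemma sum_norm_inner_gnsClass_sq_le {τ : A →ₚ[ℂ] ℂ} (hτ : IsPureState τ)
    (hA : ∀ a b : A, a * b = b * a) {y : Fin n → E} (hy : muStar A y ≤ 1) (z : E) :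
    ∑ i, ‖inner ℂ (gnsClass τ (y i)) (gnsClass τ z)‖ ^ 2 ≤ ‖gnsClass τ z‖ ^ 2 := by
  rcases eq_or_ne (gnsClass τ z) 0 with h0 | h0
  · simp [h0]
  have ht : 0 < ‖gnsClass τ z‖ ^ 2 := by positivity
  have hc : τ (rinner A z z) = ((‖gnsClass τ z‖ ^ 2 : ℝ) : ℂ) := by
    rw [norm_gnsClass_sq, ofReal_re_apply_of_nonneg τ (rinner_self_nonneg z)]
  simp only [gnsClass_inner]
  set t := ‖gnsClass τ z‖ ^ 2
  set s := ∑ i, ‖τ (rinner A (y i) z)‖ ^ 2 with hs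
  have key : ∀ ε : ℝ, 0 < ε → t * s ≤ (t + ε) ^ 2 := by
    intro ε hε
    set b := cfcₙ (regInvSqrt ε) (rinner A z z) with hb
    have hβ : ‖τ b‖ ^ 2 * (t + ε) ^ 2 = t := by
      have h := congrArg τ (regInvSqrt_mul_add_mul_self hε (rinner_self_nonneg (A := A) z))
      rw [hτ.map_mul hA, map_add, hτ.map_mul hA, apply_real_smul, hc, ← hb] at h
      have h' := congrArg norm h
      rw [← mul_pow]
      calc (‖τ b‖ * (t + ε)) ^ 2 = ‖τ b * ((t + ε : ℝ) : ℂ)‖ ^ 2 := by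
            rw [norm_mul, Complex.norm_real, Real.norm_of_nonneg (by positivity)]
        _ = ‖τ b * (t : ℂ) + ε * τ b‖ * ‖τ b * (t : ℂ) + ε * τ b‖ := by
            rw [sq]; push_cast; congr 2 <;> ring
        _ = t := by rw [← norm_mul, h', Complex.norm_real, Real.norm_of_nonneg ht.le]
    have h1 := (muStar_le_one_iff y).1 hy (normalize A ε z) (norm_normalize_le hε z)
    have h2 := (re_apply_le_norm τ (∑ i, absSq (rinner A (y i) (normalize A ε z)))).trans_eq
      (by rw [hτ.norm_eq_one, one_mul])
    rw [hτ.re_map_sum_absSq hA] at h2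
    have h3 : ∑ i, ‖τ (rinner A (y i) (normalize A ε z))‖ ^ 2 = s * ‖τ b‖ ^ 2 := by
      rw [hs, Finset.sum_mul]
      refine Finset.sum_congr rfl fun i _ => ?_
      rw [rinner_normalize_right, hτ.map_mul hA, norm_mul, mul_pow]
    rw [h3] at h2
    calc t * s = (s * ‖τ b‖ ^ 2) * (t + ε) ^ 2 := by rw [mul_assoc, hβ]; ring
      _ ≤ 1 * (t + ε) ^ 2 := by gcongr; exact h2.trans h1
      _ = _ := one_mul _
  have hlim : t * s ≤ t ^ 2 := by
    have hcont : Filter.Tendsto (fun ε : ℝ => (t + ε) ^ 2) (nhdsWithin 0 (Set.Ioi 0))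
        (nhds (t ^ 2)) := by
      have : Continuous fun ε : ℝ => (t + ε) ^ 2 := by fun_prop
      simpa using (this.tendsto 0).mono_left nhdsWithin_le_nhds
    exact ge_of_tendsto hcont (Filter.eventually_of_mem self_mem_nhdsWithin key)
  nlinarith

theorem starNorm_le_pureNorm (hA : ∀ a b : A, a * b = b * a)
    (hdim : ∀ τ : PureState A, (n : Cardinal) ≤ oDim (GNSSpace τ.1 E)) (x : Fin n → E) :
    starNorm A x ≤ pureNorm A x := by
  refine Real.sSup_le ?_ (pureNorm_nonneg x)
  rintro _ ⟨y, hy, rfl⟩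
  set s := ∑ i, absSq (rinner A (y i) (x i)) with hs
  rcases eq_or_ne s 0 with h0 | h0
  · simpa [h0] using pureNorm_nonneg x
  obtain ⟨τ, hτ⟩ := exists_pureState_apply_eq_norm (sum_absSq_nonneg _ _) h0
  refine (Real.sqrt_le_left (hilbertMultiNorm_nonneg _)).2 ?_ |>.trans
    (hilbertMultiNorm_gnsClass_le_pureNorm τ x)
  have hsum : ‖s‖ = ∑ i, ‖inner ℂ (gnsClass τ.1 (y i)) (gnsClass τ.1 (x i))‖ ^ 2 := by
    simp only [gnsClass_inner]
    rw [← τ.2.re_map_sum_absSq hA, hτ, Complex.ofReal_re]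
  rw [hsum]
  refine sum_norm_inner_sq_le_hilbertMultiNorm_sq (hdim τ) _ _ fun w => ?_
  induction w using gnsClass_induction with
  | hp => exact isClosed_le (by fun_prop) (by fun_prop)
  | h z => exact sum_norm_inner_gnsClass_sq_le τ.2 hA hy z

end Commutative

end HilbertMultiNorm

end

theorem mainTheorem2 {A E : Type*} [NonUnitalCStarAlgebra A] [PartialOrder A] [StarOrderedRing A]
    [NormedAddCommGroup E] [NormedSpace ℂ E] [CompleteSpace E] [SMul Aᵐᵒᵖ E] [CStarModule Aᵐᵒᵖ E]
    {n : ℕ} (x : Fin n → E) :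
    HilbertMultiNorm.hilbertMultiNorm Aᵐᵒᵖ x ≤ HilbertMultiNorm.starNorm A x ∧
    HilbertMultiNorm.hilbertMultiNorm Aᵐᵒᵖ x ≤ HilbertMultiNorm.pureNorm A x ∧
    ((∀ a b : A, a * b = b * a) →
      (∀ τ : HilbertMultiNorm.PureState A,
        (n : Cardinal) ≤ HilbertMultiNorm.oDim (HilbertMultiNorm.GNSSpace τ.1 E)) →
      HilbertMultiNorm.starNorm A x ≤ HilbertMultiNorm.pureNorm A x) := by
  exact ⟨HilbertMultiNorm.hilbertMultiNorm_le_starNorm x,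
    HilbertMultiNorm.hilbertMultiNorm_le_pureNorm x,
    fun hA hdim => HilbertMultiNorm.starNorm_le_pureNorm hA hdim x⟩
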